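/- **Notation.** Let $n\ge 2$ and $\mathbb{S}^n=\{x\in\mathbb{R}^{n+1}:\|x\|=1\}$; interiors $A^\circ$ are taken on $\mathbb{S}^n$. Put $P(x)=I_{n+1}-xx^\top$, $d_s(x,a)=1-x^\top a$ and $d_s(x,A)=\inf_{a\in A}d_s(x,a)$. For $p>0$ let $\mathcal{D}_p(A)=\{x\in\mathbb{S}^n: d_s(x,A)\le p\}$ and $\mathcal{N}_p(A)=\mathcal{D}_p(A)\setminus A^\circ$. For $a\neq -b$ in $\mathbb{S}^n$ let $\mathcal{G}(a,b)$ be the minimal geodesic from $a$ to $b$ (the points $\frac{\sin((1-\lambda)\theta)a+\sin(\lambda\theta)b}{\sin\theta}$, $\lambda\in[0,1]$, $\theta=\arccos(a^\top b)$; $\mathcal{G}(a,a)=\{a\}$). For $A\subset\mathbb{S}^n$ let $\sigma(A)=\{g\in A: -g\notin A,\ \mathcal{G}(g,x)\subset A\ \text{for all } x\in A\}$; $A$ is called star-shaped if $\sigma(A)\neq\emptyset$. **Setting.** Let $\mathcal{U}_1,\dots,\mathcal{U}_m\subset\mathbb{S}^n$ ($m\ge1$) be closed star-shaped sets, $\mathcal{U}=\bigcup_i\mathcal{U}_i$,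 $\mathcal{M}_0=\mathbb{S}^n\setminus\mathcal{U}^\circ$, $x_d\in\mathcal{M}_0^\circ$, and let $g_i\in\sigma(\mathcal{U}_i)\cap\mathcal{U}_i^\circ$ with $g_i\ne -x_d$ for every $i$. Let $\bar\epsilon>0$ be such that $x_d\notin\mathcal{N}_{\bar\epsilon}(\mathcal{U})$, and let $k_1>0$ and $\kappa>0$. Assume: 1. for some $\delta\in[0,2]$, $d_s(a,b)\ge\delta$ for all $a\in\mathcal{U}_i$, $b\in\mathcal{U}_j$, $i\ne j$; and $0<\epsilon<\min\{\bar\epsilon,\,1-\sqrt{(2-\delta)/2}\}$; 2. $\mathcal{R}_i\cap\mathcal{R}_j=\emptyset$ for $i\neq j$, where, if $-x_d\notin\mathcal{D}_\epsilon(\mathcal{U}_i)$, $$\mathcal{R}_i=\Big\{x\in\bigcup_{y\in\mathcal{D}_\epsilon(\mathcal{U}_i)}\mathcal{G}(y,x_d)\setminus\mathcal{U}_i^\circ:\ d_s(x,x_d)\ge d_s(x_d,\mathcal{D}_\epsilon(\mathcal{U}_i))\Big\},$$ and $\mathcal{R}_i=\bigcup_{y\in\mathcal{D}_\epsilon(\mathcal{U}_i)}\mathcal{G}(y,-x_d)\setminus\mathcal{U}_i^\circ$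 otherwise. Consider on $\mathbb{S}^n$ the closed-loop system $\dot x=P(x)u(x)$ with $$u(x)=\begin{cases}k_1\Big(\frac{d_s(x,\mathcal{U}_i)}{\epsilon}\,x_d-\frac1\kappa\Big(1-\frac{d_s(x,\mathcal{U}_i)}{\epsilon}\Big)g_i\Big), & x\in\mathcal{N}_\epsilon(\mathcal{U}_i),\\ k_1x_d, & x\notin\mathcal{N}_\epsilon(\mathcal{U}).\end{cases}$$ **Theorem.** 1. For every $\kappa>0$ the set $\mathcal{M}_0$ is forward invariant: from every $x(0)\in\mathcal{M}_0$ there is a solution defined for all $t\ge0$, and every solution with $x(0)\in\mathcal{M}_0$ satisfies $x(t)\in\mathcal{M}_0$ as long as it is defined. 2. There is $\bar\kappa>0$ (independent of $\kappa$) such that for every $\kappa>\bar\kappa$ the point $x_d$ is an almost globally asymptotically stable equilibrium over $\mathcal{M}_0$: it is an equilibrium, it is Lyapunov stable and locally attractive for solutions in $\mathcal{M}_0$, and there is a set $Z\subset\mathcal{M}_0$ of zero Lebesgue (surface) measure on $\mathbb{S}^n$ such that every solution with $x(0)\in\mathcal{M}_0\setminus Z$ satisfies $\lim_{t\to\infty}d_s(x(t),x_d)=0$.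 -/

import Mathlib

open Set Filter Topology MeasureTheory

noncomputable section

namespace SphereNav

/-- The ambient Euclidean space of dimension `n + 1`. -/
abbrev Amb (n : ℕ) : Type := EuclideanSpace ℝ (Fin (n + 1))

/-- The unit `n`-sphere, with the subspace topology. In particular `interior`, `IsClosed` and
`frontier` of a `Set (Sph n)` are taken on the sphere. -/
abbrev Sph (n : ℕ) : Type := Metric.sphere (0 : Amb n) 1

variable {n : ℕ}

/-- The orthogonal projection `P(x) a = (I - x xᵀ) a`. -/
def proj (x : Sph n) (a : Amb n) : Amb n :=
  a - inner ℝ (x : Amb n) a • (x : Amb n)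

/-- The spherical distance between two points, `1 - xᵀ a`. -/
def sdist (x a : Sph n) : ℝ := 1 - inner ℝ (x : Amb n) (a : Amb n)

/-- The spherical distance from a point to a set, `inf_{a ∈ A} (1 - xᵀ a)`. -/
def sdistSet (x : Sph n) (A : Set (Sph n)) : ℝ := ⨅ a : A, sdist x a

/-- The dilation of `A` by `p`. -/
def dilation (p : ℝ) (A : Set (Sph n)) : Set (Sph n) := {x | sdistSet x A ≤ p}

/-- The `p`-neighbourhood of `A`, that is, the dilation without the interior of `A`. -/
def nbhd (p : ℝ) (A : Set (Sph n)) : Set (Sph n) := dilation p A \ interior A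

/-- The geodesic joining `a` and `b`, for `a ≠ -b`: the spherical linear interpolation
`(sin ((1 - l) θ) a + sin (l θ) b) / sin θ`, `l ∈ [0, 1]`, with `θ = arccos (aᵀ b)`,
extended by continuity to the constant curve when `a = b`. -/
def geodesic (a b : Sph n) : Set (Sph n) :=
  {x | (a = b ∧ x = a) ∨
    (a ≠ b ∧ ∃ l ∈ Icc (0 : ℝ) 1,
      (x : Amb n) =
        (Real.sin (Real.arccos (inner ℝ (a : Amb n) (b : Amb n))))⁻¹ •
          (Real.sin ((1 - l) * Real.arccos (inner ℝ (a : Amb n) (b : Amb n))) • (a : Amb n) +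
            Real.sin (l * Real.arccos (inner ℝ (a : Amb n) (b : Amb n))) • (b : Amb n)))}

/-- `σ(A)`: the points from which `A` is star-shaped on the sphere. -/
def starCenters (A : Set (Sph n)) : Set (Sph n) :=
  {g | g ∈ A ∧ -g ∉ A ∧ ∀ x ∈ A, geodesic g x ⊆ A}

/-- A set is star-shaped on the sphere if it has a star center. -/
def IsStarShaped (A : Set (Sph n)) : Prop := (starCenters A).Nonempty

/-- `M_p`: the points outside the interior of the unsafe set `W` at distance at least `p`
from it. -/
def freeSpace (p : ℝ) (W : Set (Sph n)) : Set (Sph n) :=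
  {x | x ∉ interior W ∧ p ≤ sdistSet x W}

/-- `Φ(δ) = 1 - √((2 - δ) / 2)`. -/
def Phi (δ : ℝ) : ℝ := 1 - Real.sqrt ((2 - δ) / 2)

/-- The law `u_i` used near the unsafe region `A` with repelling point `g`:
`(d(x, A) / ε) x_d - (1 / κ) (1 - d(x, A) / ε) g`. -/
def localControl (A : Set (Sph n)) (g xd : Sph n) (κ ε : ℝ) (x : Sph n) : Amb n :=
  (sdistSet x A / ε) • (xd : Amb n) - ((1 / κ) * (1 - sdistSet x A / ε)) • (g : Amb n)

open Classical in
/-- The feedback law: `k₁ u_i(x)` if `x` is in the `ε`-neighbourhood of the unsafe region `U i`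
(for the regions considered there is at most one such `i`), and `k₁ x_d` otherwise. -/
def control {m : ℕ} (U : Fin m → Set (Sph n)) (g : Fin m → Sph n) (xd : Sph n)
    (k₁ κ ε : ℝ) (x : Sph n) : Amb n :=
  if h : ∃ i, x ∈ nbhd ε (U i) then
    k₁ • localControl (U h.choose) (g h.choose) xd κ ε x
  else k₁ • (xd : Amb n)

/-- The closed-loop vector field `P(x) u(x)`. -/
def closedLoop {m : ℕ} (U : Fin m → Set (Sph n)) (g : Fin m → Sph n) (xd : Sph n)
    (k₁ κ ε : ℝ) (x : Sph n) : Amb n :=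
  proj x (control U g xd k₁ κ ε x)

/-- The union of all geodesics from points of `A` to `y`. -/
def geodesicHull (A : Set (Sph n)) (y : Sph n) : Set (Sph n) := ⋃ x ∈ A, geodesic x y

open Classical in
/-- The region `R` attached to the unsafe region `A`. If `-x_d` is not in the `ε`-dilation of `A`,
it consists of the points, outside the interior of `A`, of the geodesics from the dilation to
`x_d` that are at least as far from `x_d` as the dilation is. If `-x_d` is in the dilation, it
consists of the points, outside the interior of `A`, of the geodesics from the dilation
to `-x_d`. -/
def region (ε : ℝ) (xd : Sph n) (A : Set (Sph n)) : Set (Sph n) :=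
  if -xd ∉ dilation ε A then
    {x | x ∈ geodesicHull (dilation ε A) xd \ interior A ∧
      sdistSet xd (dilation ε A) ≤ sdist x xd}
  else geodesicHull (dilation ε A) (-xd) \ interior A

/-- `x` is a (classical) solution on the time interval `I` of `ẋ = f(x)` on the sphere. -/
def IsSolutionOn (f : Sph n → Amb n) (I : Set ℝ) (x : ℝ → Sph n) : Prop :=
  ∀ t ∈ I, HasDerivWithinAt (fun s => (x s : Amb n)) (f (x t)) I t

/-- `M` is forward invariant for `ẋ = f(x)`: every initial condition in `M` has a solution defined
for all `t ≥ 0`, and no solution starting in `M` ever leaves `M`. -/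
def IsForwardInvariant (f : Sph n → Amb n) (M : Set (Sph n)) : Prop :=
  (∀ x₀ ∈ M, ∃ x : ℝ → Sph n, x 0 = x₀ ∧ IsSolutionOn f (Ici 0) x) ∧
  ∀ (T : ℝ) (x : ℝ → Sph n), IsSolutionOn f (Ico 0 T) x → x 0 ∈ M → ∀ t ∈ Ico 0 T, x t ∈ M

/-- The equilibrium `xd` is almost globally asymptotically stable over `M` for `ẋ = f(x)`:
it is stable and locally attractive, and it attracts every solution starting in `M` outside a
set of zero Lebesgue (surface) measure on the sphere. -/
structure IsAGAS (f : Sph n → Amb n) (M : Set (Sph n)) (xd : Sph n) : Prop where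
  equilibrium : f xd = 0
  stable : ∀ r > 0, ∃ s > 0, ∀ x : ℝ → Sph n, IsSolutionOn f (Ici 0) x → x 0 ∈ M →
    sdist (x 0) xd < s → ∀ t ≥ 0, sdist (x t) xd < r
  locally_attractive : ∃ s > 0, ∀ x : ℝ → Sph n, IsSolutionOn f (Ici 0) x → x 0 ∈ M →
    sdist (x 0) xd < s → Tendsto (fun t => sdist (x t) xd) atTop (𝓝 0)
  almost_globally_attractive : ∃ Z ⊆ M, (volume : Measure (Amb n)).toSphere Z = 0 ∧
    ∀ x : ℝ → Sph n, IsSolutionOn f (Ici 0) x → x 0 ∈ M \ Z →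
      Tendsto (fun t => sdist (x t) xd) atTop (𝓝 0)

end SphereNav

end

/-!
Along a solution of `ẋ = P(x) (α x_d - β g)` some positive multiple `p x` satisfies
`p x = x(0) + A x_d - B g` with `A' = p α` and `B' = p β` (`exists_lift`). All motions of the closed
loop are of this form while a single region is active, so their geometry is linear, and monotone
since `α, β ≥ 0`.

*Invariance.* The feedback has a Lipschitz extension `contControl` across the interiors of the
regions, under which the motion inside `U i` is directed away from `g i`. Since the interior of a
star-shaped set is closed under motion towards a star center
(`mem_interior_of_starCenter`), the extended flow cannot enter it; this gives global solutions in
the free space. An arbitrary solution of the discontinuous closed loop could enter an interior only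
at a point where the two one-sided fields agree, which the same cone argument excludes
(`Admissible.notMem_interior_of_closedLoop`).

*Convergence.* Between visits to the dilations a solution follows a geodesic to the target, and
disjointness of the regions `R i` makes the distance from the target to the visited dilation
decrease from one visit to the next (`Admissible.rank_lt_of_consecutive`). Hence eventually only one
dilation is visited. From then on `p x = x(s) + A x_d - B g`, and if `x(s)` is not in the plane of
`x_d` and `g` then `p` is bounded below, so `A + κ B → ∞` and `x` approaches the arc from `x_d`
to `-g`. That arc has positive distance from the region, because the region is star-shaped
about `g` and misses `x_d`; there the attraction dominates for large `κ`, and `x` is driven into a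
ball around `x_d` that it no longer leaves (`Admissible.exists_sdist_lt`,
`Admissible.tendsto_of_near`).

*Exceptional set.* Solutions that hit one of the planes at a rational time form a countable union of
preimages of great circles under flow maps with Lipschitz inverse, and such preimages are null for
`n ≥ 2` by a Hausdorff dimension count (`toSphere_eq_zero_of_mem_plane`). No stable manifold theorem
is needed, which matters because the distance functions are merely Lipschitz.
-/

noncomputable section

namespace SphereNav

variable {n : ℕ}

/-! ### Spherical distances -/

lemma norm_coe (x : Sph n) : ‖(x : Amb n)‖ = 1 := norm_eq_of_mem_sphere x

lemma inner_coe_self (x : Sph n) : inner ℝ (x : Amb n) (x : Amb n) = 1 := by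
  rw [real_inner_self_eq_norm_sq, norm_coe, one_pow]

lemma inner_coe_le_one (x y : Sph n) : inner ℝ (x : Amb n) (y : Amb n) ≤ 1 := by
  simpa [norm_coe] using real_inner_le_norm (x : Amb n) (y : Amb n)

lemma sdist_comm (x y : Sph n) : sdist x y = sdist y x := by
  rw [sdist, sdist, real_inner_comm]

lemma sdist_nonneg (x y : Sph n) : 0 ≤ sdist x y := sub_nonneg.2 (inner_coe_le_one x y)

lemma norm_sub_sq_eq_sdist (x y : Sph n) : ‖(x : Amb n) - y‖ ^ 2 = 2 * sdist x y := by
  rw [norm_sub_sq_real, norm_coe, norm_coe, sdist]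
  ring

lemma sdist_eq_zero {x y : Sph n} (h : sdist x y = 0) : x = y := by
  have h1 := norm_sub_sq_eq_sdist x y
  rw [h, mul_zero, sq_eq_zero_iff, norm_eq_zero, sub_eq_zero] at h1
  exact Subtype.ext h1

/-- The function `y ↦ inf_{a ∈ A} (1 - yᵀ a)` on the ambient space; it restricts to
`sdistSet · A` on the sphere. -/
def extDist (A : Set (Sph n)) (y : Amb n) : ℝ := ⨅ a : A, (1 - inner ℝ y ((a : Sph n) : Amb n))

lemma inner_le_norm_coe (y : Amb n) (a : Sph n) : inner ℝ y (a : Amb n) ≤ ‖y‖ := by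
  simpa [norm_coe] using real_inner_le_norm y (a : Amb n)

lemma extDist_le {A : Set (Sph n)} {a : Sph n} (ha : a ∈ A) (y : Amb n) :
    extDist A y ≤ 1 - inner ℝ y (a : Amb n) := by
  refine ciInf_le ⟨1 - ‖y‖, ?_⟩ (⟨a, ha⟩ : A)
  rintro _ ⟨b, rfl⟩
  have := inner_le_norm_coe y (b : Sph n)
  dsimp only
  linarith

lemma exists_extDist_eq {A : Set (Sph n)} (hA : IsClosed A) (hne : A.Nonempty) (y : Amb n) :
    ∃ a ∈ A, extDist A y = 1 - inner ℝ y (a : Amb n) := by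
  obtain ⟨a, ha, hmin⟩ := hA.isCompact.exists_isMinOn hne
    (f := fun a : Sph n => 1 - inner ℝ y (a : Amb n)) (by fun_prop)
  have : Nonempty A := hne.to_subtype
  exact ⟨a, ha, le_antisymm (extDist_le ha y) (le_ciInf fun b => hmin b.2)⟩

lemma lipschitzWith_extDist {A : Set (Sph n)} (hA : IsClosed A) (hne : A.Nonempty) :
    LipschitzWith 1 (extDist A) := by
  refine LipschitzWith.of_le_add fun x y => ?_
  obtain ⟨a, ha, h⟩ := exists_extDist_eq hA hne y
  have h1 := extDist_le ha x
  have h2 := inner_le_norm_coe (y - x) a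
  rw [inner_sub_left] at h2
  rw [dist_comm, dist_eq_norm]
  linarith

lemma sdistSet_le {A : Set (Sph n)} {a : Sph n} (ha : a ∈ A) (x : Sph n) :
    sdistSet x A ≤ sdist x a := extDist_le ha x

lemma sdistSet_nonneg (x : Sph n) (A : Set (Sph n)) : 0 ≤ sdistSet x A :=
  Real.iInf_nonneg fun _ => sdist_nonneg _ _

lemma sdistSet_of_mem {x : Sph n} {A : Set (Sph n)} (hx : x ∈ A) : sdistSet x A = 0 := by
  refine le_antisymm ((sdistSet_le hx x).trans_eq ?_) (sdistSet_nonneg x A)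
  rw [sdist, inner_coe_self, sub_self]

lemma sdistSet_anti {A B : Set (Sph n)} (h : A ⊆ B) (hne : A.Nonempty) (x : Sph n) :
    sdistSet x B ≤ sdistSet x A := by
  have : Nonempty A := hne.to_subtype
  exact le_ciInf fun a => sdistSet_le (h a.2) x

lemma continuous_sdistSet {A : Set (Sph n)} (hA : IsClosed A) (hne : A.Nonempty) :
    Continuous fun x : Sph n => sdistSet x A :=
  (lipschitzWith_extDist hA hne).continuous.comp continuous_subtype_val

lemma isClosed_dilation {A : Set (Sph n)} (hA : IsClosed A) (hne : A.Nonempty) (p : ℝ) :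
    IsClosed (dilation p A) :=
  isClosed_le (continuous_sdistSet hA hne) continuous_const

lemma subset_dilation {A : Set (Sph n)} {p : ℝ} (hp : 0 ≤ p) : A ⊆ dilation p A := fun x hx => by
  rw [dilation, mem_ofPred_eq, sdistSet_of_mem hx]
  exact hp

/-- If `A` and `B` are `δ`-separated, their `ε`-dilations are disjoint for `ε < Φ(δ)`: a point `x`
of both would have nearest points `a`, `b` with `xᵀ (a + b) > 2 √((2 - δ) / 2) ≥ ‖a + b‖`. -/
lemma disjoint_dilation {A B : Set (Sph n)} (hA : IsClosed A) (hAne : A.Nonempty)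
    (hB : IsClosed B) (hBne : B.Nonempty) {δ ε : ℝ} (hδ : δ ≤ 2) (hε : ε < Phi δ)
    (hsep : ∀ a ∈ A, ∀ b ∈ B, δ ≤ sdist a b) : Disjoint (dilation ε A) (dilation ε B) := by
  rw [Set.disjoint_left]
  intro x hxA hxB
  obtain ⟨a, ha, h1⟩ := exists_extDist_eq hA hAne (x : Amb n)
  obtain ⟨b, hb, h2⟩ := exists_extDist_eq hB hBne (x : Amb n)
  have hxA' : extDist A x ≤ ε := hxA
  have hxB' : extDist B x ≤ ε := hxB
  have hs := hsep a ha b hb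
  have hsq : Real.sqrt ((2 - δ) / 2) ^ 2 = (2 - δ) / 2 := Real.sq_sqrt (by linarith)
  have h0 := Real.sqrt_nonneg ((2 - δ) / 2)
  have h3 : ‖(a : Amb n) + b‖ ^ 2 ≤ (2 * Real.sqrt ((2 - δ) / 2)) ^ 2 := by
    rw [norm_add_sq_real, norm_coe, norm_coe, mul_pow, hsq]
    rw [sdist] at hs
    linarith
  have h4 : ‖(a : Amb n) + b‖ ≤ 2 * Real.sqrt ((2 - δ) / 2) :=
    (sq_le_sq₀ (norm_nonneg _) (by positivity)).1 h3
  have h5 := real_inner_le_norm (x : Amb n) ((a : Amb n) + b)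
  rw [inner_add_right, norm_coe, one_mul] at h5
  rw [Phi] at hε
  linarith

/-! ### Geodesics and star centers -/

/-- The minimal geodesic from `a` to `b` is the part of the sphere in the cone spanned by `a`
and `b`. -/
lemma mem_geodesic_of_nonneg {a b w : Sph n} (hab : a ≠ -b) {α β : ℝ} (hα : 0 ≤ α) (hβ : 0 ≤ β)
    (hw : (w : Amb n) = α • (a : Amb n) + β • (b : Amb n)) : w ∈ geodesic a b := by
  by_cases hab' : a = b
  · subst hab'
    refine Or.inl ⟨rfl, Subtype.ext ?_⟩
    rw [← add_smul] at hw
    have h1 : ‖(w : Amb n)‖ = α + β := by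
      rw [hw, norm_smul, norm_coe, mul_one, Real.norm_of_nonneg (by positivity)]
    rw [hw, ← h1, norm_coe, one_smul]
  refine Or.inr ⟨hab', ?_⟩
  set c := inner ℝ (a : Amb n) (b : Amb n) with hc
  have hc1 : c < 1 := by
    refine lt_of_le_of_ne (inner_coe_le_one a b) fun h => hab' (sdist_eq_zero ?_)
    rw [sdist, ← hc, h, sub_self]
  have hc2 : -1 < c := by
    have h1 := inner_coe_le_one a (-b)
    have h2 : inner ℝ (a : Amb n) ((-b : Sph n) : Amb n) = -c := by
      rw [show ((-b : Sph n) : Amb n) = -(b : Amb n) from rfl, inner_neg_right]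
    refine lt_of_le_of_ne (by linarith) fun h => hab (sdist_eq_zero ?_)
    rw [sdist, h2, ← h]
    norm_num
  set θ := Real.arccos c with hθ
  have hcos : Real.cos θ = c := Real.cos_arccos hc2.le hc1.le
  have hθ0 : 0 < θ := Real.arccos_pos.2 hc1
  have hθπ : θ < Real.pi := by
    refine lt_of_le_of_ne (Real.arccos_le_pi c) fun h => ?_
    rw [h, Real.cos_pi] at hcos
    linarith
  have hsin : 0 < Real.sin θ := Real.sin_pos_of_pos_of_lt_pi hθ0 hθπ
  -- In the orthonormal frame `a, (b - c a) / sin θ` the point `w` is `(cos φ, sin φ)`.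
  have hnorm : (α + β * c) ^ 2 + (β * Real.sin θ) ^ 2 = 1 := by
    have h1 : ‖(w : Amb n)‖ ^ 2 = 1 := by rw [norm_coe, one_pow]
    rw [hw, norm_add_sq_real, norm_smul, norm_smul, norm_coe, norm_coe, real_inner_smul_left,
      real_inner_smul_right, ← hc, Real.norm_of_nonneg hα, Real.norm_of_nonneg hβ] at h1
    have h2 := Real.sin_sq_add_cos_sq θ
    rw [hcos] at h2
    linear_combination h1 + β ^ 2 * h2
  set φ := Real.arccos (α + β * c) with hφ
  have hcosφ : Real.cos φ = α + β * c :=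
    Real.cos_arccos (by nlinarith [sq_nonneg (β * Real.sin θ)])
      (by nlinarith [sq_nonneg (β * Real.sin θ)])
  have hsinφ : Real.sin φ = β * Real.sin θ := by
    rw [hφ, Real.sin_arccos, ← hnorm, add_sub_cancel_left, Real.sqrt_sq (by positivity)]
  have hsub : Real.sin (θ - φ) = α * Real.sin θ := by
    rw [Real.sin_sub, hcosφ, hsinφ, hcos]
    ring
  have hφθ : φ ≤ θ := by
    by_contra! h
    have h1 : Real.sin (θ - φ) < 0 :=
      Real.sin_neg_of_neg_of_neg_pi_lt (by linarith) (by linarith [Real.arccos_le_pi (α + β * c)])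
    rw [hsub] at h1
    exact absurd h1 (not_lt.2 (by positivity))
  have hφ0 : 0 ≤ φ := Real.arccos_nonneg _
  refine ⟨φ / θ, ⟨by positivity, (div_le_one hθ0).2 hφθ⟩, ?_⟩
  have e1 : (1 - φ / θ) * θ = θ - φ := by field_simp
  have e2 : φ / θ * θ = φ := by field_simp
  rw [e1, e2, hsub, hsinφ, hw, smul_add, smul_smul, smul_smul]
  congr 2 <;> field_simp

/-- The point of the sphere on the ray through `y`; it is `y₀` if `y = 0`. -/
def normalize (y₀ : Sph n) (y : Amb n) : Sph n :=
  if h : y = 0 then y₀ else ⟨‖y‖⁻¹ • y, by simp [norm_smul, h]⟩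

lemma coe_normalize (y₀ : Sph n) {y : Amb n} (h : y ≠ 0) :
    (normalize y₀ y : Amb n) = ‖y‖⁻¹ • y := by rw [normalize, dif_neg h]

lemma norm_smul_normalize (y₀ : Sph n) (y : Amb n) : ‖y‖ • (normalize y₀ y : Amb n) = y := by
  by_cases h : y = 0
  · simp [h]
  · rw [coe_normalize y₀ h, smul_inv_smul₀ (norm_ne_zero_iff.2 h)]

lemma continuousAt_normalize (y₀ : Sph n) {y : Amb n} (h : y ≠ 0) :
    ContinuousAt (normalize y₀) y := by
  rw [Topology.IsInducing.subtypeVal.continuousAt_iff]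
  have h1 : ContinuousAt (fun z : Amb n => ‖z‖⁻¹ • z) y :=
    (continuousAt_id.norm.inv₀ (norm_ne_zero_iff.2 h)).smul continuousAt_id
  refine h1.congr ?_
  filter_upwards [isOpen_ne.mem_nhds h] with z hz
  exact (coe_normalize y₀ hz).symm

lemma normalize_eq {y₀ x : Sph n} {p : ℝ} (hp : 0 < p) : normalize y₀ (p • (x : Amb n)) = x := by
  have hx : (x : Amb n) ≠ 0 := norm_ne_zero_iff.1 (by rw [norm_coe]; exact one_ne_zero)
  refine Subtype.ext ?_
  rw [coe_normalize _ (smul_ne_zero hp.ne' hx), norm_smul, norm_coe, mul_one,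
    Real.norm_of_nonneg hp.le, inv_smul_smul₀ hp.ne']

/-- A set contains the conical combinations of its points with a star center. -/
lemma mem_of_starCenter {A : Set (Sph n)} {g y w : Sph n} (hg : g ∈ starCenters A) (hy : y ∈ A)
    {α β : ℝ} (hα : 0 ≤ α) (hβ : 0 ≤ β)
    (hw : (w : Amb n) = α • (y : Amb n) + β • (g : Amb n)) : w ∈ A := by
  refine hg.2.2 y hy (mem_geodesic_of_nonneg (fun h => hg.2.1 ?_) hβ hα (by rw [hw, add_comm]))
  rwa [h, neg_neg]

/-- Moving an interior point towards a star center keeps it in the interior. -/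
lemma mem_interior_of_starCenter {A : Set (Sph n)} {g y w : Sph n} (hg : g ∈ starCenters A)
    (hy : y ∈ interior A) {α β : ℝ} (hα : 0 < α) (hβ : 0 ≤ β)
    (hw : (w : Amb n) = α • (y : Amb n) + β • (g : Amb n)) : w ∈ interior A := by
  -- Near `w`, the point `w'` is a conical combination of `g` and the direction of `w' - β g`.
  have hsub : (w : Amb n) - β • (g : Amb n) = α • (y : Amb n) := by rw [hw, add_sub_cancel_right]
  have hy0 : (y : Amb n) ≠ 0 := norm_ne_zero_iff.1 (by rw [norm_coe]; exact one_ne_zero)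
  have hne : (w : Amb n) - β • (g : Amb n) ≠ 0 := by
    rw [hsub]
    exact smul_ne_zero hα.ne' hy0
  have hcont : ContinuousAt (fun v : Sph n => normalize y ((v : Amb n) - β • (g : Amb n))) w :=
    ContinuousAt.comp (f := fun v : Sph n => (v : Amb n) - β • (g : Amb n))
      (continuousAt_normalize y hne) (by fun_prop)
  have hval : normalize y ((w : Amb n) - β • (g : Amb n)) = y := by rw [hsub, normalize_eq hα]
  rw [mem_interior_iff_mem_nhds]
  have hmem : A ∈ 𝓝 (normalize y ((w : Amb n) - β • (g : Amb n))) := by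
    rw [hval]
    exact mem_interior_iff_mem_nhds.1 hy
  filter_upwards [hcont hmem] with v hv
  refine mem_of_starCenter hg hv (norm_nonneg ((v : Amb n) - β • (g : Amb n))) hβ ?_
  rw [norm_smul_normalize, sub_add_cancel]

/-! ### Solutions of Lipschitz equations on the sphere -/

/-- A bounded Lipschitz vector field has solutions on the half-line `[0, ∞)`. -/
lemma exists_forall_hasDerivWithinAt_Ici {E : Type*} [NormedAddCommGroup E] [NormedSpace ℝ E]
    [CompleteSpace E] {G : E → E} {K L : NNReal} (hG : LipschitzWith K G) (hL : ∀ y, ‖G y‖ ≤ L)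
    (x₀ : E) :
    ∃ x : ℝ → E, x 0 = x₀ ∧ ∀ t ∈ Ici (0 : ℝ), HasDerivWithinAt x (G (x t)) (Ici 0) t := by
  have hex : ∀ N : ℕ, ∃ x : ℝ → E, x 0 = x₀ ∧
      ∀ t ∈ Icc (0 : ℝ) N, HasDerivWithinAt x (G (x t)) (Icc 0 N) t := by
    intro N
    have hPL : IsPicardLindelof (fun _ => G) (⟨0, left_mem_Icc.2 N.cast_nonneg⟩ : Icc (0 : ℝ) N)
        x₀ (L * N) 0 L K := by
      refine ⟨fun _ _ => hG.lipschitzOnWith, fun _ _ => continuousOn_const, fun _ _ y _ => hL y, ?_⟩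
      simp
    exact hPL.exists_eq_forall_mem_Icc_hasDerivWithinAt₀
  choose φ hφ0 hφ using hex
  have hagree : ∀ {N M : ℕ} {t : ℝ}, 0 ≤ t → t ≤ N → N ≤ M → φ N t = φ M t := by
    intro N M t h0 hN hNM
    have hNM' : (N : ℝ) ≤ M := by exact_mod_cast hNM
    refine ODE_solution_unique_of_mem_Icc_right (v := fun _ => G) (s := fun _ => univ) (a := 0)
      (b := N) (fun _ _ => hG.lipschitzOnWith) (fun s hs => (hφ N s hs).continuousWithinAt)
      (fun s hs => ?_) (fun _ _ => mem_univ _)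
      (fun s hs => ((hφ M s ⟨hs.1, hs.2.trans hNM'⟩).continuousWithinAt).mono
        (Icc_subset_Icc_right hNM'))
      (fun s hs => ?_) (fun _ _ => mem_univ _) (by rw [hφ0, hφ0]) ⟨h0, hN⟩
    · exact (hφ N s ⟨hs.1, hs.2.le⟩).mono_of_mem_nhdsWithin
        (mem_of_superset (Icc_mem_nhdsGE hs.2) (Icc_subset_Icc_left hs.1))
    · exact (hφ M s ⟨hs.1, hs.2.le.trans hNM'⟩).mono_of_mem_nhdsWithin
        (mem_of_superset (Icc_mem_nhdsGE (hs.2.trans_le hNM')) (Icc_subset_Icc_left hs.1))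
  have hx : ∀ {N : ℕ} {s : ℝ}, 0 ≤ s → s < N → φ (⌊s⌋₊ + 1) s = φ N s := by
    intro N s h0 hN
    refine hagree h0 ?_ ((Nat.floor_lt h0).2 hN)
    exact_mod_cast (Nat.lt_floor_add_one s).le
  refine ⟨fun t => φ (⌊t⌋₊ + 1) t, hφ0 _, fun t ht => ?_⟩
  have ht' : t < (⌊t⌋₊ + 1 : ℕ) := by exact_mod_cast Nat.lt_floor_add_one t
  refine ((hφ _ t ⟨ht, ht'.le⟩).mono_of_mem_nhdsWithin ?_).congr_of_eventuallyEq ?_ rfl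
  · filter_upwards [self_mem_nhdsWithin, mem_nhdsWithin_of_mem_nhds (Iio_mem_nhds ht')] with s h1 h2
    exact ⟨h1, le_of_lt h2⟩
  · filter_upwards [self_mem_nhdsWithin, mem_nhdsWithin_of_mem_nhds (Iio_mem_nhds ht')] with s h1 h2
    exact hx h1 h2

/-- The field `y ↦ u(y) - (yᵀ u(y)) y`, which extends `P(y) u(y)` to the ambient space. -/
def tangentField (u : Amb n → Amb n) (y : Amb n) : Amb n := u y - inner ℝ y (u y) • y

lemma tangentField_coe (u : Amb n → Amb n) (x : Sph n) : tangentField u x = proj x (u x) := rfl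

lemma exists_bound_of_lipschitzOnWith {u : Amb n → Amb n} {K : NNReal}
    (hu : LipschitzOnWith K u (Metric.closedBall 0 1)) :
    ∃ M : NNReal, ∀ y ∈ Metric.closedBall (0 : Amb n) 1, ‖u y‖ ≤ M := by
  obtain ⟨C, hC⟩ :=
    (isCompact_closedBall (0 : Amb n) 1).exists_bound_of_continuousOn hu.continuousOn
  exact ⟨C.toNNReal, fun y hy => (hC y hy).trans (Real.le_coe_toNNReal C)⟩

lemma abs_inner_le {y v : Amb n} {r : ℝ} (hy : ‖y‖ ≤ 1) (hv : ‖v‖ ≤ r) : |inner ℝ y v| ≤ r := by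
  have h1 := abs_real_inner_le_norm y v
  nlinarith [norm_nonneg y, norm_nonneg v]

lemma lipschitzOnWith_tangentField {u : Amb n → Amb n} {K M : NNReal}
    (hu : LipschitzOnWith K u (Metric.closedBall 0 1))
    (hM : ∀ y ∈ Metric.closedBall (0 : Amb n) 1, ‖u y‖ ≤ M) :
    LipschitzOnWith (2 * K + 2 * M) (tangentField u) (Metric.closedBall 0 1) := by
  refine LipschitzOnWith.of_dist_le_mul fun y hy z hz => ?_
  have hd := hu.dist_le_mul y hy z hz
  rw [dist_eq_norm, dist_eq_norm] at hd
  have hMy := hM y hy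
  have hMz := hM z hz
  rw [mem_closedBall_zero_iff] at hy hz
  have e : tangentField u y - tangentField u z = (u y - u z) -
      ((inner ℝ y (u y)) • (y - z) + (inner ℝ z (u y - u z) + inner ℝ (u y) (y - z)) • z) := by
    simp only [tangentField, inner_sub_right, real_inner_comm (u y)]
    module
  have h1 : |inner ℝ y (u y)| ≤ M := abs_inner_le hy hMy
  have h2 : |inner ℝ z (u y - u z)| ≤ K * ‖y - z‖ := abs_inner_le hz hd
  have h3 : |inner ℝ (u y) (y - z)| ≤ M * ‖y - z‖ :=
    (abs_real_inner_le_norm _ _).trans (mul_le_mul_of_nonneg_right hMy (norm_nonneg _))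
  rw [dist_eq_norm, dist_eq_norm, e]
  have h4 : ‖(inner ℝ y (u y)) • (y - z)‖ ≤ M * ‖y - z‖ := by
    rw [norm_smul]
    exact mul_le_mul_of_nonneg_right h1 (norm_nonneg _)
  have h5 : ‖(inner ℝ z (u y - u z) + inner ℝ (u y) (y - z)) • z‖ ≤
      K * ‖y - z‖ + M * ‖y - z‖ := by
    rw [norm_smul, Real.norm_eq_abs]
    have h6 := (abs_add_le (inner ℝ z (u y - u z)) (inner ℝ (u y) (y - z))).trans
      (add_le_add h2 h3)
    nlinarith [norm_nonneg z, abs_nonneg (inner ℝ z (u y - u z) + inner ℝ (u y) (y - z))]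
  have h7 := norm_sub_le (u y - u z)
    ((inner ℝ y (u y)) • (y - z) + (inner ℝ z (u y - u z) + inner ℝ (u y) (y - z)) • z)
  have h8 := norm_add_le ((inner ℝ y (u y)) • (y - z))
    ((inner ℝ z (u y - u z) + inner ℝ (u y) (y - z)) • z)
  push_cast
  linarith

/-- The radial retraction onto the closed unit ball. -/
def ballRetract (y : Amb n) : Amb n := (max 1 ‖y‖)⁻¹ • y

lemma ballRetract_mem (y : Amb n) : ballRetract y ∈ Metric.closedBall (0 : Amb n) 1 := by
  have h : 0 < max 1 ‖y‖ := lt_max_of_lt_left one_pos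
  rw [mem_closedBall_zero_iff, ballRetract, norm_smul, norm_inv, Real.norm_of_nonneg h.le,
    inv_mul_le_one₀ h]
  exact le_max_right _ _

lemma ballRetract_of_norm_le {y : Amb n} (hy : ‖y‖ ≤ 1) : ballRetract y = y := by
  rw [ballRetract, max_eq_left hy, inv_one, one_smul]

lemma lipschitzWith_ballRetract : LipschitzWith 2 (ballRetract : Amb n → Amb n) := by
  refine LipschitzWith.of_dist_le_mul fun y z => ?_
  have hy : 0 < max 1 ‖y‖ := lt_max_of_lt_left one_pos
  have hz : 0 < max 1 ‖z‖ := lt_max_of_lt_left one_pos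
  have e : ballRetract y - ballRetract z = (max 1 ‖y‖)⁻¹ •
      ((y - z) + ((max 1 ‖z‖ - max 1 ‖y‖) * (max 1 ‖z‖)⁻¹) • z) := by
    rw [ballRetract, ballRetract, smul_add, smul_smul]
    have : (max 1 ‖y‖)⁻¹ * ((max 1 ‖z‖ - max 1 ‖y‖) * (max 1 ‖z‖)⁻¹) =
        (max 1 ‖y‖)⁻¹ - (max 1 ‖z‖)⁻¹ := by field_simp
    rw [this]
    module
  have h1 : |max 1 ‖z‖ - max 1 ‖y‖| ≤ ‖y - z‖ := by
    refine (abs_max_sub_max_le_max _ _ _ _).trans ?_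
    rw [sub_self, abs_zero, max_le_iff]
    refine ⟨norm_nonneg _, ?_⟩
    rw [norm_sub_rev]
    exact abs_norm_sub_norm_le z y
  have h2 : (max 1 ‖z‖)⁻¹ * ‖z‖ ≤ 1 := by
    rw [inv_mul_le_one₀ hz]
    exact le_max_right _ _
  have h3 : ‖((max 1 ‖z‖ - max 1 ‖y‖) * (max 1 ‖z‖)⁻¹) • z‖ ≤ ‖y - z‖ := by
    rw [norm_smul, norm_mul, norm_inv, Real.norm_of_nonneg hz.le, Real.norm_eq_abs, mul_assoc]
    exact (mul_le_of_le_one_right (abs_nonneg _) h2).trans h1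
  rw [dist_eq_norm, dist_eq_norm, e, norm_smul, norm_inv, Real.norm_of_nonneg hy.le]
  have h4 : (max 1 ‖y‖)⁻¹ ≤ 1 := inv_le_one_of_one_le₀ (le_max_left _ _)
  have h5 := norm_add_le (y - z) (((max 1 ‖z‖ - max 1 ‖y‖) * (max 1 ‖z‖)⁻¹) • z)
  refine (mul_le_of_le_one_left (norm_nonneg _) h4).trans ?_
  push_cast
  linarith

/-- Outside the unit ball the retracted field is tangent to the spheres around the origin; inside,
its radial component vanishes to first order at the unit sphere. -/
lemma abs_inner_tangentField_ballRetract_le {u : Amb n → Amb n} {M : NNReal}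
    (hM : ∀ y ∈ Metric.closedBall (0 : Amb n) 1, ‖u y‖ ≤ M) (y : Amb n) :
    |inner ℝ y (tangentField u (ballRetract y))| ≤ M * |‖y‖ ^ 2 - 1| := by
  rcases le_or_gt ‖y‖ 1 with hy | hy
  · have h1 : inner ℝ y (tangentField u y) = inner ℝ y (u y) * (1 - ‖y‖ ^ 2) := by
      rw [tangentField, inner_sub_right, real_inner_smul_right, real_inner_self_eq_norm_sq]
      ring
    rw [ballRetract_of_norm_le hy, h1, abs_mul, abs_sub_comm]
    exact mul_le_mul_of_nonneg_right (abs_inner_le hy (hM y (mem_closedBall_zero_iff.2 hy)))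
      (abs_nonneg _)
  · have h1 : inner ℝ y (tangentField u (ballRetract y)) = 0 := by
      have h0 : ‖y‖ ≠ 0 := by positivity
      rw [tangentField, inner_sub_right, real_inner_smul_right]
      simp only [ballRetract, max_eq_right hy.le, real_inner_smul_left, real_inner_smul_right,
        real_inner_self_eq_norm_sq]
      field_simp
      ring
    rw [h1, abs_zero]
    positivity

lemma exists_solution_on_sphere {u : Amb n → Amb n} {K : NNReal}
    (hu : LipschitzOnWith K u (Metric.closedBall 0 1)) (x₀ : Sph n) :
    ∃ x : ℝ → Sph n, x 0 = x₀ ∧ IsSolutionOn (fun y => proj y (u y)) (Ici 0) x := by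
  obtain ⟨M, hM⟩ := exists_bound_of_lipschitzOnWith hu
  have hlip := lipschitzOnWith_tangentField hu hM
  set G : Amb n → Amb n := fun y => tangentField u (ballRetract y) with hG
  have hGlip : LipschitzWith ((2 * K + 2 * M) * 2) G := by
    rw [← lipschitzOnWith_univ]
    exact hlip.comp (lipschitzWith_ballRetract.lipschitzOnWith (s := univ))
      fun y _ => ballRetract_mem y
  obtain ⟨L, hL⟩ := exists_bound_of_lipschitzOnWith hlip
  obtain ⟨x, hx0, hx⟩ := exists_forall_hasDerivWithinAt_Ici hGlip
    (fun y => hL _ (ballRetract_mem y)) (x₀ : Amb n)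
  have hnorm : ∀ t ∈ Ici (0 : ℝ), ‖x t‖ = 1 := by
    intro t ht
    have hderiv : ∀ s ∈ Ici (0 : ℝ), HasDerivWithinAt (fun r => ‖x r‖ ^ 2 - 1)
        (2 * inner ℝ (x s) (G (x s))) (Ici 0) s := fun s hs => ((hx s hs).norm_sq).sub_const 1
    have h1 := eq_zero_of_abs_deriv_le_mul_abs_self_of_eq_zero_right (K := 2 * M) (a := 0) (b := t)
      (fun s hs => (hderiv s hs.1).continuousWithinAt.mono Icc_subset_Ici_self)
      (fun s hs => (hderiv s hs.1).mono (Ici_subset_Ici.2 hs.1)) (by simp [hx0])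
      (fun s hs => ?_) t ⟨ht, le_rfl⟩
    · have h2 : ‖x t‖ ^ 2 = 1 := by linarith
      exact (pow_eq_one_iff_of_nonneg (norm_nonneg _) two_ne_zero).1 h2
    · have h2 := abs_inner_tangentField_ballRetract_le hM (x s)
      rw [norm_mul, Real.norm_eq_abs, Real.norm_eq_abs, Real.norm_eq_abs, abs_two]
      linarith
  refine ⟨fun t => if h : ‖x t‖ = 1 then ⟨x t, mem_sphere_zero_iff_norm.2 h⟩ else x₀, ?_, ?_⟩
  · refine Subtype.ext ?_
    dsimp only
    rw [dif_pos (hnorm 0 self_mem_Ici)]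
    exact hx0
  · intro t ht
    have heq : ∀ s ∈ Ici (0 : ℝ), ((if h : ‖x s‖ = 1 then
        (⟨x s, mem_sphere_zero_iff_norm.2 h⟩ : Sph n) else x₀ : Sph n) : Amb n) = x s :=
      fun s hs => by rw [dif_pos (hnorm s hs)]
    have h1 := (hx t ht).congr heq (heq t ht)
    refine h1.congr_deriv ?_
    dsimp only
    rw [← tangentField_coe, heq t ht, hG]
    dsimp only
    rw [ballRetract_of_norm_le (hnorm t ht).le]

/-- Solutions separate at most exponentially in backward time. -/
lemma dist_zero_le_of_solutions {u : Amb n → Amb n} {K : NNReal}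
    (hu : LipschitzOnWith K u (Metric.closedBall 0 1)) {q : ℝ} (hq : 0 ≤ q) :
    ∃ L : NNReal, ∀ x y : ℝ → Sph n, IsSolutionOn (fun z => proj z (u z)) (Ici 0) x →
      IsSolutionOn (fun z => proj z (u z)) (Ici 0) y →
      dist (x 0 : Amb n) (y 0) ≤ L * dist (x q : Amb n) (y q) := by
  obtain ⟨M, hM⟩ := exists_bound_of_lipschitzOnWith hu
  have hlip := lipschitzOnWith_tangentField hu hM
  have hlip' : LipschitzOnWith (2 * K + 2 * M) (fun z => -tangentField u z)
      (Metric.closedBall 0 1) := by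
    refine LipschitzOnWith.of_dist_le_mul fun y hy z hz => ?_
    rw [dist_neg_neg]
    exact hlip.dist_le_mul y hy z hz
  refine ⟨⟨Real.exp ((2 * K + 2 * M : NNReal) * q), (Real.exp_pos _).le⟩, fun x y hx hy => ?_⟩
  have hcont : ∀ z : ℝ → Sph n, IsSolutionOn (fun z => proj z (u z)) (Ici 0) z →
      ContinuousOn (fun s => (z (q - s) : Amb n)) (Icc 0 q) := by
    intro z hz s hs
    exact ContinuousWithinAt.comp (g := fun r => (z r : Amb n)) (f := fun s => q - s) (t := Ici 0)
      (hz (q - s) (sub_nonneg.2 hs.2)).continuousWithinAt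
      (by fun_prop) (fun r hr => sub_nonneg.2 hr.2)
  have hderiv : ∀ z : ℝ → Sph n, IsSolutionOn (fun z => proj z (u z)) (Ici 0) z →
      ∀ s ∈ Ico 0 q, HasDerivWithinAt (fun s => (z (q - s) : Amb n))
        (-tangentField u (z (q - s))) (Ici s) s := by
    intro z hz s hs
    have h1 : HasDerivAt (fun s => (z s : Amb n)) (tangentField u (z (q - s))) (q - s) :=
      (hz (q - s) (sub_nonneg.2 hs.2.le)).hasDerivAt (Ici_mem_nhds (sub_pos.2 hs.2))
    exact (h1.comp_const_sub q s).hasDerivWithinAt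
  have h := dist_le_of_trajectories_ODE_of_mem (v := fun _ z => -tangentField u z)
    (s := fun _ => Metric.closedBall 0 1) (fun _ _ => hlip') (hcont x hx) (hderiv x hx)
    (fun _ _ => mem_closedBall_zero_iff.2 (norm_coe _).le) (hcont y hy) (hderiv y hy)
    (fun _ _ => mem_closedBall_zero_iff.2 (norm_coe _).le) le_rfl q ⟨hq, le_rfl⟩
  simp only [sub_self, sub_zero] at h
  rw [mul_comm] at h
  exact h

/-! ### Linearization of solutions -/

/-- Along a solution of `ẋ = P(x) (α a - β b)` a positive multiple of `x` has velocity in the cone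
spanned by `a` and `-b`. -/
lemma exists_lift {x : ℝ → Sph n} (hx : Continuous x) {α β : ℝ → ℝ} (hα : Continuous α)
    (hβ : Continuous β) (a b : Amb n) (t₀ : ℝ) :
    ∃ p A B : ℝ → ℝ, (∀ t, 0 < p t) ∧ A t₀ = 0 ∧ B t₀ = 0 ∧
      (∀ t, HasDerivAt A (p t * α t) t) ∧ (∀ t, HasDerivAt B (p t * β t) t) ∧
      ∀ t ≥ t₀, (∀ s ∈ Ico t₀ t, HasDerivWithinAt (fun r => (x r : Amb n))
        (proj (x s) (α s • a - β s • b)) (Ici s) s) →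
        p t • (x t : Amb n) = x t₀ + A t • a - B t • b := by
  have hint : ∀ {f : ℝ → ℝ}, Continuous f →
      ∀ t, HasDerivAt (fun t => ∫ s in t₀..t, f s) (f t) t := fun {f} hf t =>
    intervalIntegral.integral_hasDerivAt_right (hf.intervalIntegrable _ _)
      (hf.stronglyMeasurableAtFilter _ _) hf.continuousAt
  have hxc : Continuous fun t => (x t : Amb n) := continuous_subtype_val.comp hx
  have hwc : Continuous fun t => inner ℝ (x t : Amb n) (α t • a - β t • b) := by fun_prop
  set p : ℝ → ℝ := fun t => Real.exp (∫ s in t₀..t, inner ℝ (x s : Amb n) (α s • a - β s • b))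
    with hp
  have hpd : ∀ t, HasDerivAt p (p t * inner ℝ (x t : Amb n) (α t • a - β t • b)) t :=
    fun t => (hint hwc t).exp
  have hpc : Continuous p := continuous_iff_continuousAt.2 fun t => (hpd t).continuousAt
  set A : ℝ → ℝ := fun t => ∫ s in t₀..t, p s * α s with hA
  set B : ℝ → ℝ := fun t => ∫ s in t₀..t, p s * β s with hB
  have hAd : ∀ t, HasDerivAt A (p t * α t) t := hint (hpc.mul hα)
  have hBd : ∀ t, HasDerivAt B (p t * β t) t := hint (hpc.mul hβ)
  refine ⟨p, A, B, fun t => Real.exp_pos _, intervalIntegral.integral_same,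
    intervalIntegral.integral_same, hAd, hBd, fun t ht hsol => ?_⟩
  have hAc : Continuous A := continuous_iff_continuousAt.2 fun t => (hAd t).continuousAt
  have hBc : Continuous B := continuous_iff_continuousAt.2 fun t => (hBd t).continuousAt
  have h := constant_of_has_deriv_right_zero (a := t₀) (b := t)
    (f := fun s => p s • (x s : Amb n) - A s • a + B s • b) (by fun_prop) (fun s hs => ?_)
    t ⟨ht, le_rfl⟩
  · have hA0 : A t₀ = 0 := intervalIntegral.integral_same
    have hB0 : B t₀ = 0 := intervalIntegral.integral_same
    have hp0 : p t₀ = 1 := by rw [hp]; simp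
    rw [hA0, hB0, hp0, one_smul, zero_smul, zero_smul, sub_zero, add_zero] at h
    rw [← h]
    module
  · refine ((((hpd s).hasDerivWithinAt.smul (hsol s hs)).sub
      ((hAd s).hasDerivWithinAt.smul_const a)).add
      ((hBd s).hasDerivWithinAt.smul_const b)).congr_deriv ?_
    rw [proj]
    module

/-- The case of constant coefficients, on a compact interval. -/
lemma exists_lift_Icc {x : ℝ → Sph n} {t₀ t₁ : ℝ} (h : t₀ ≤ t₁) (hx : ContinuousOn x (Icc t₀ t₁))
    (α β : ℝ) (a b : Amb n)
    (hsol : ∀ s ∈ Ico t₀ t₁, HasDerivWithinAt (fun r => (x r : Amb n))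
        (proj (x s) (α • a - β • b)) (Ici s) s) :
    ∃ p q : ℝ → ℝ, (∀ t, 0 < p t) ∧ q t₀ = 0 ∧ (∀ t, HasDerivAt q (p t) t) ∧
      ∀ t ∈ Icc t₀ t₁, p t • (x t : Amb n) = x t₀ + (α * q t) • a - (β * q t) • b := by
  set y : ℝ → Sph n := fun t => x (projIcc t₀ t₁ h t) with hy
  have hyx : ∀ t ∈ Icc t₀ t₁, y t = x t := fun t ht => by
    rw [hy]
    dsimp only
    rw [projIcc_of_mem h ht]
  have hyc : Continuous y := hx.comp_continuous (by fun_prop) fun t => (projIcc t₀ t₁ h t).2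
  obtain ⟨p, q, B, hp, hq0, -, hq, -, hlift⟩ := exists_lift hyc (α := fun _ => 1) (β := fun _ => 0)
    continuous_const continuous_const (α • a - β • b) 0 t₀
  refine ⟨p, q, hp, hq0, fun t => by simpa using hq t, fun t ht => ?_⟩
  have h1 := hlift t ht.1 fun s hs => ?_
  · rw [hyx t ht, hyx t₀ ⟨le_rfl, h⟩] at h1
    rw [h1]
    module
  · have hs' : s ∈ Ico t₀ t₁ := ⟨hs.1, hs.2.trans_le ht.2⟩
    have h2 : y s = x s := hyx s ⟨hs'.1, hs'.2.le⟩
    simp only [one_smul, zero_smul, sub_zero]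
    rw [h2]
    refine (hsol s hs').congr_of_eventuallyEq ?_ (by rw [h2])
    filter_upwards [Icc_mem_nhdsGE hs'.2] with r hr
    rw [hyx r ⟨hs'.1.trans hr.1, hr.2⟩]

/-! ### Null sets on the sphere -/

/-- The homogeneous extension of degree one of a Lipschitz map on the unit sphere. -/
lemma exists_lipschitzOnWith_homogeneous {R : Amb n → Amb n} {L : NNReal}
    (hR : LipschitzWith L R) :
    ∃ K : NNReal, LipschitzOnWith K (fun y => ‖y‖ • R (‖y‖⁻¹ • y)) {0}ᶜ := by
  obtain ⟨M, hM⟩ := exists_bound_of_lipschitzOnWith hR.lipschitzOnWith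
  refine ⟨M + L * 2, LipschitzOnWith.of_dist_le_mul fun y hy z hz => ?_⟩
  have hy' : 0 < ‖y‖ := norm_pos_iff.2 hy
  have hz' : 0 < ‖z‖ := norm_pos_iff.2 hz
  have hMy : ‖R (‖y‖⁻¹ • y)‖ ≤ M := hM _ (by simp [norm_smul, hy'.ne'])
  have h1 : ‖R (‖y‖⁻¹ • y) - R (‖z‖⁻¹ • z)‖ ≤ L * ‖‖y‖⁻¹ • y - ‖z‖⁻¹ • z‖ := by
    simpa [dist_eq_norm] using hR.dist_le_mul (‖y‖⁻¹ • y) (‖z‖⁻¹ • z)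
  have h2 : ‖z‖ * ‖‖y‖⁻¹ • y - ‖z‖⁻¹ • z‖ ≤ 2 * ‖y - z‖ := by
    have e : ‖z‖ * ‖‖y‖⁻¹ • y - ‖z‖⁻¹ • z‖ = ‖(y - z) + ((‖z‖ - ‖y‖) * ‖y‖⁻¹) • y‖ := by
      rw [← Real.norm_of_nonneg hz'.le, norm_norm, ← norm_smul_of_nonneg hz'.le]
      congr 1
      rw [smul_sub, smul_inv_smul₀ hz'.ne', smul_smul, sub_mul, mul_inv_cancel₀ hy'.ne']
      module
    have h3 : ‖((‖z‖ - ‖y‖) * ‖y‖⁻¹) • y‖ ≤ ‖y - z‖ := by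
      rw [norm_smul, norm_mul, norm_inv, norm_norm, mul_assoc, inv_mul_cancel₀ hy'.ne', mul_one,
        norm_sub_rev y z]
      exact abs_norm_sub_norm_le z y
    rw [e]
    linarith [norm_add_le (y - z) (((‖z‖ - ‖y‖) * ‖y‖⁻¹) • y)]
  have e : ‖y‖ • R (‖y‖⁻¹ • y) - ‖z‖ • R (‖z‖⁻¹ • z) =
      (‖y‖ - ‖z‖) • R (‖y‖⁻¹ • y) + ‖z‖ • (R (‖y‖⁻¹ • y) - R (‖z‖⁻¹ • z)) := by module
  have h4 : ‖(‖y‖ - ‖z‖) • R (‖y‖⁻¹ • y)‖ ≤ ‖y - z‖ * M := by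
    rw [norm_smul]
    exact mul_le_mul (abs_norm_sub_norm_le y z) hMy (norm_nonneg _) (norm_nonneg _)
  have h5 : ‖‖z‖ • (R (‖y‖⁻¹ • y) - R (‖z‖⁻¹ • z))‖ ≤ L * (2 * ‖y - z‖) := by
    rw [norm_smul, norm_norm]
    calc ‖z‖ * ‖R (‖y‖⁻¹ • y) - R (‖z‖⁻¹ • z)‖ ≤ ‖z‖ * (L * ‖‖y‖⁻¹ • y - ‖z‖⁻¹ • z‖) := by gcongr
      _ = L * (‖z‖ * ‖‖y‖⁻¹ • y - ‖z‖⁻¹ • z‖) := by ring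
      _ ≤ L * (2 * ‖y - z‖) := by gcongr
  rw [dist_eq_norm, dist_eq_norm, e]
  push_cast
  linarith [norm_add_le ((‖y‖ - ‖z‖) • R (‖y‖⁻¹ • y)) (‖z‖ • (R (‖y‖⁻¹ • y) - R (‖z‖⁻¹ • z)))]

lemma dimH_span_pair_le (a b : Amb n) :
    dimH ((Submodule.span ℝ {a, b} : Submodule ℝ (Amb n)) : Set (Amb n)) ≤ 2 := by
  set W : Submodule ℝ (Amb n) := Submodule.span ℝ {a, b}
  have h1 : dimH (range (Subtype.val : W → Amb n)) = dimH (univ : Set W) := by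
    rw [← image_univ]
    exact isometry_subtype_coe.dimH_image _
  have h2 : Module.finrank ℝ W ≤ 2 := by
    classical
    have h3 := finrank_span_finset_le_card (R := ℝ) ({a, b} : Finset (Amb n))
    rw [Finset.coe_pair] at h3
    exact h3.trans Finset.card_le_two
  rw [Subtype.range_coe_subtype, Real.dimH_univ_eq_finrank] at h1
  have h3 : dimH (W : Set (Amb n)) = (Module.finrank ℝ W : ENNReal) := h1
  rw [h3]
  exact_mod_cast h2

open scoped Pointwise in
/-- If a map with Lipschitz inverse sends `S` into a plane through the origin, then `S` is a null
set of the sphere: the cone over `S` is covered by a Lipschitz image of the plane, which has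
Hausdorff dimension at most `2 < n + 1`. -/
lemma toSphere_eq_zero_of_mem_plane (hn : 2 ≤ n) {S : Set (Sph n)} {φ : Sph n → Sph n} {L : NNReal}
    {a b : Amb n} (hφ : ∀ z ∈ S, (φ z : Amb n) ∈ Submodule.span ℝ {a, b})
    (hL : ∀ z ∈ S, ∀ w ∈ S, dist (z : Amb n) w ≤ L * dist (φ z : Amb n) (φ w)) :
    (volume : Measure (Amb n)).toSphere S = 0 := by
  rcases S.eq_empty_or_nonempty with rfl | ⟨z₀, hz₀⟩
  · exact measure_empty
  set f : Sph n → Amb n := fun z => (φ z : Amb n) with hf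
  have : Nonempty (Sph n) := ⟨z₀⟩
  have hinv : ∀ z ∈ S, Function.invFunOn f S (f z) = z := by
    intro z hz
    have h1 : ∃ w ∈ S, f w = f z := ⟨z, hz, rfl⟩
    have h2 := hL _ (Function.invFunOn_mem h1) z hz
    rw [show (φ (Function.invFunOn f S (f z)) : Amb n) = φ z from Function.invFunOn_eq h1,
      dist_self, mul_zero] at h2
    exact Subtype.ext (dist_le_zero.1 h2)
  have hR₀ : LipschitzOnWith L (fun y => ((Function.invFunOn f S y : Sph n) : Amb n)) (f '' S) := by
    refine LipschitzOnWith.of_dist_le_mul ?_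
    rintro _ ⟨z, hz, rfl⟩ _ ⟨w, hw, rfl⟩
    rw [hinv z hz, hinv w hw]
    exact hL z hz w hw
  obtain ⟨R, hR, hRS⟩ := hR₀.extend_finite_dimension
  obtain ⟨K, hK⟩ := exists_lipschitzOnWith_homogeneous hR
  set W : Submodule ℝ (Amb n) := Submodule.span ℝ {a, b} with hW
  -- A compact subset of the sphere that contains `S`; measurability is needed for the cone formula.
  set S' : Set (Sph n) := {z | (z : Amb n) ∈ R '' ((W : Set (Amb n)) ∩ Metric.sphere 0 1)} with hS'
  have hcomp : IsCompact (R '' ((W : Set (Amb n)) ∩ Metric.sphere 0 1)) :=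
    ((isCompact_sphere 0 1).inter_left W.closed_of_finiteDimensional).image hR.continuous
  have hmeas : MeasurableSet S' :=
    (hcomp.isClosed.preimage continuous_subtype_val).measurableSet
  have hsub : S ⊆ S' := fun z hz => ⟨f z, ⟨hφ z hz, (φ z).2⟩, by
    rw [← hRS (mem_image_of_mem f hz)]
    exact congrArg Subtype.val (hinv z hz)⟩
  refine measure_mono_null hsub ?_
  rw [Measure.toSphere_apply' _ hmeas]
  have hcone : Ioo (0 : ℝ) 1 • ((↑) '' S' : Set (Amb n)) ⊆
      (fun y => ‖y‖ • R (‖y‖⁻¹ • y)) '' ((W : Set (Amb n)) \ {0}) := by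
    rintro _ ⟨r, hr, _, ⟨z, ⟨w, ⟨hwW, hw⟩, hwz⟩, rfl⟩, rfl⟩
    have hw1 : ‖w‖ = 1 := mem_sphere_zero_iff_norm.1 hw
    have hrw : ‖r • w‖ = r := by rw [norm_smul, hw1, mul_one, Real.norm_of_nonneg hr.1.le]
    refine ⟨r • w, ⟨W.smul_mem r hwW, ?_⟩, ?_⟩
    · rw [mem_singleton_iff, ← norm_eq_zero, hrw]
      exact hr.1.ne'
    · dsimp only
      rw [hrw, inv_smul_smul₀ hr.1.ne', hwz]
  have hdim : dimH (Ioo (0 : ℝ) 1 • ((↑) '' S' : Set (Amb n))) ≤ 2 :=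
    (dimH_mono hcone).trans (((hK.mono fun y hy => hy.2).dimH_image_le).trans
      ((dimH_mono sdiff_subset).trans (dimH_span_pair_le a b)))
  have hac : (volume : Measure (Amb n)) ≪ μH[Module.finrank ℝ (Amb n)] :=
    Measure.absolutelyContinuous_isAddHaarMeasure _ _
  have hzero : (volume : Measure (Amb n)) (Ioo (0 : ℝ) 1 • ((↑) '' S' : Set (Amb n))) = 0 := by
    refine measure_zero_of_dimH_lt (d := Module.finrank ℝ (Amb n)) (by exact_mod_cast hac)
      (hdim.trans_lt ?_)
    rw [finrank_euclideanSpace, Fintype.card_fin]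
    exact_mod_cast (by omega : 2 < n + 1)
  rw [hzero, mul_zero]

/-! ### The Lipschitz extension of the feedback law -/

/-- The standing assumptions on the unsafe regions in the form in which the dynamics uses them:
the separation hypothesis enters through the disjointness of the dilations. -/
structure Admissible {m : ℕ} (U : Fin m → Set (Sph n)) (g : Fin m → Sph n) (xd : Sph n)
    (ε : ℝ) : Prop where
  isClosed : ∀ i, IsClosed (U i)
  starCenter : ∀ i, g i ∈ starCenters (U i)
  pos : 0 < ε
  disjoint : ∀ i j, i ≠ j → Disjoint (dilation ε (U i)) (dilation ε (U j))
  target_notMem : ∀ i, xd ∉ dilation ε (U i)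
  region_disjoint : ∀ i j, i ≠ j → Disjoint (region ε xd (U i)) (region ε xd (U j))

/-- The weight of the attractive term near `A`: the distance to `A` in units of `ε`, capped
at `1`. -/
def weight (ε : ℝ) (A : Set (Sph n)) (y : Amb n) : ℝ := min 1 (extDist A y / ε)

/-- A feedback law on the ambient space that agrees with `control` on the free space, but treats
the interior of an unsafe region like its boundary; unlike `control` it is Lipschitz. -/
def contControl {m : ℕ} (U : Fin m → Set (Sph n)) (g : Fin m → Sph n) (xd : Sph n)
    (k₁ κ ε : ℝ) (y : Amb n) : Amb n :=
  k₁ • (xd : Amb n) -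
    ∑ i, (k₁ * (1 - weight ε (U i) y)) • ((xd : Amb n) + (1 / κ) • (g i : Amb n))

lemma weight_le_one (ε : ℝ) (A : Set (Sph n)) (y : Amb n) : weight ε A y ≤ 1 := min_le_left _ _

lemma weight_nonneg {ε : ℝ} (hε : 0 < ε) (A : Set (Sph n)) (x : Sph n) :
    0 ≤ weight ε A (x : Amb n) :=
  le_min zero_le_one (div_nonneg (sdistSet_nonneg x A) hε.le)

lemma weight_of_mem_dilation {ε : ℝ} (hε : 0 < ε) {A : Set (Sph n)} {x : Sph n}
    (hx : x ∈ dilation ε A) : weight ε A (x : Amb n) = sdistSet x A / ε :=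
  min_eq_right ((div_le_one hε).2 hx)

lemma weight_of_le {ε : ℝ} (hε : 0 < ε) {A : Set (Sph n)} {x : Sph n}
    (hx : ε ≤ sdistSet x A) : weight ε A (x : Amb n) = 1 :=
  min_eq_left ((one_le_div hε).2 hx)

lemma weight_of_notMem_dilation {ε : ℝ} (hε : 0 < ε) {A : Set (Sph n)} {x : Sph n}
    (hx : x ∉ dilation ε A) : weight ε A (x : Amb n) = 1 :=
  weight_of_le hε (not_le.1 hx).le

lemma contControl_of_weight {m : ℕ} {U : Fin m → Set (Sph n)} {g : Fin m → Sph n} {xd : Sph n}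
    {k₁ κ ε : ℝ} {x : Sph n} (hx : ∀ i, weight ε (U i) x = 1) :
    contControl U g xd k₁ κ ε x = k₁ • (xd : Amb n) := by
  simp [contControl, hx]

lemma exists_lipschitzWith_sum {ι E F : Type*} [PseudoMetricSpace E] [SeminormedAddCommGroup F]
    (s : Finset ι) {f : ι → E → F} (hf : ∀ i, ∃ K : NNReal, LipschitzWith K (f i)) :
    ∃ K : NNReal, LipschitzWith K (fun y => ∑ i ∈ s, f i y) := by
  classical
  induction s using Finset.induction_on with
  | empty => exact ⟨0, by simpa using LipschitzWith.const (0 : F)⟩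
  | insert i s hi ih =>
    obtain ⟨K, hK⟩ := ih
    obtain ⟨K', hK'⟩ := hf i
    refine ⟨K' + K, ?_⟩
    simp only [Finset.sum_insert hi]
    exact hK'.add hK

lemma interior_iUnion_of_disjoint {X ι : Type*} [TopologicalSpace X] [Finite ι] {U : ι → Set X}
    (hU : ∀ i, IsClosed (U i)) (hd : ∀ i j, i ≠ j → Disjoint (U i) (U j)) :
    interior (⋃ i, U i) = ⋃ i, interior (U i) := by
  refine Subset.antisymm (fun x hx => ?_) (iUnion_subset fun i => interior_mono (subset_iUnion U i))
  obtain ⟨i, hi⟩ := mem_iUnion.1 (interior_subset hx)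
  refine mem_iUnion.2 ⟨i, ?_⟩
  have h1 : IsClosed (⋃ j ∈ {j | j ≠ i}, U j) := (Set.toFinite _).isClosed_biUnion fun j _ => hU j
  have h2 : x ∈ (⋃ j ∈ {j | j ≠ i}, U j)ᶜ := by
    simp only [mem_compl_iff, mem_iUnion, not_exists]
    exact fun j hj hxj => Set.disjoint_left.1 (hd j i hj) hxj hi
  refine mem_interior_iff_mem_nhds.2 ?_
  filter_upwards [h1.isOpen_compl.mem_nhds h2, isOpen_interior.mem_nhds hx] with y hy1 hy2
  obtain ⟨j, hj⟩ := mem_iUnion.1 (interior_subset hy2)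
  by_contra hyi
  refine hy1 (mem_iUnion₂.2 ⟨j, fun h => hyi ?_, hj⟩)
  rwa [← h]

lemma mem_freeSpace_zero {W : Set (Sph n)} {x : Sph n} : x ∈ freeSpace 0 W ↔ x ∉ interior W :=
  ⟨fun h => h.1, fun h => ⟨h, sdistSet_nonneg x W⟩⟩

namespace Admissible

variable {m : ℕ} {U : Fin m → Set (Sph n)} {g : Fin m → Sph n} {xd : Sph n} {k₁ κ ε : ℝ}

lemma nonempty (h : Admissible U g xd ε) (i : Fin m) : (U i).Nonempty := ⟨g i, (h.starCenter i).1⟩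

lemma mem_freeSpace_iff (h : Admissible U g xd ε) {x : Sph n} :
    x ∈ freeSpace 0 (⋃ i, U i) ↔ ∀ i, x ∉ interior (U i) := by
  rw [mem_freeSpace_zero, interior_iUnion_of_disjoint h.isClosed fun i j hij =>
    (h.disjoint i j hij).mono (subset_dilation h.pos.le) (subset_dilation h.pos.le)]
  simp

lemma isClosed_dilation (h : Admissible U g xd ε) (i : Fin m) : IsClosed (dilation ε (U i)) :=
  SphereNav.isClosed_dilation (h.isClosed i) (h.nonempty i) ε

lemma notMem_of_mem (h : Admissible U g xd ε) {x : Sph n} {i j : Fin m}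
    (hx : x ∈ dilation ε (U i)) (hij : j ≠ i) : x ∉ dilation ε (U j) :=
  fun hj => Set.disjoint_left.1 (h.disjoint j i hij) hj hx

lemma contControl_eq (h : Admissible U g xd ε) {x : Sph n} {i : Fin m}
    (hx : ∀ j, j ≠ i → x ∉ dilation ε (U j)) :
    contControl U g xd k₁ κ ε x = (k₁ * weight ε (U i) x) • (xd : Amb n) -
      (k₁ / κ * (1 - weight ε (U i) x)) • (g i : Amb n) := by
  rw [contControl, Finset.sum_eq_single i]
  · module
  · intro j _ hj
    rw [weight_of_notMem_dilation h.pos (hx j hj), sub_self, mul_zero, zero_smul]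
  · simp

lemma control_of_mem_nbhd (h : Admissible U g xd ε) {x : Sph n} {i : Fin m}
    (hx : x ∈ nbhd ε (U i)) :
    control U g xd k₁ κ ε x = k₁ • localControl (U i) (g i) xd κ ε x := by
  have hex : ∃ i, x ∈ nbhd ε (U i) := ⟨i, hx⟩
  have hi : hex.choose = i := by
    by_contra hne
    exact h.notMem_of_mem hx.1 hne hex.choose_spec.1
  rw [control, dif_pos hex, hi]

lemma closedLoop_of_mem_interior (h : Admissible U g xd ε) {x : Sph n} {i : Fin m}
    (hx : x ∈ interior (U i)) :
    closedLoop U g xd k₁ κ ε x = proj x (k₁ • (xd : Amb n)) := by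
  rw [closedLoop, control, dif_neg]
  rintro ⟨j, hj⟩
  by_cases hij : j = i
  · subst hij
    exact hj.2 hx
  · exact h.notMem_of_mem (subset_dilation h.pos.le (interior_subset hx)) hij hj.1

lemma closedLoop_of_mem_boundary (h : Admissible U g xd ε) {x : Sph n} {i : Fin m}
    (hx : x ∈ U i) (hx' : x ∉ interior (U i)) :
    closedLoop U g xd k₁ κ ε x = proj x (-(k₁ / κ) • (g i : Amb n)) := by
  rw [closedLoop, h.control_of_mem_nbhd ⟨subset_dilation h.pos.le hx, hx'⟩, localControl,
    sdistSet_of_mem hx]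
  congr 1
  module

lemma closedLoop_eq (h : Admissible U g xd ε) {x : Sph n} (hx : x ∈ freeSpace 0 (⋃ i, U i)) :
    closedLoop U g xd k₁ κ ε x = proj x (contControl U g xd k₁ κ ε x) := by
  rw [h.mem_freeSpace_iff] at hx
  rw [closedLoop]
  congr 1
  by_cases hex : ∃ i, x ∈ dilation ε (U i)
  · obtain ⟨i, hi⟩ := hex
    rw [h.control_of_mem_nbhd ⟨hi, hx i⟩, h.contControl_eq fun j hj => h.notMem_of_mem hi hj,
      localControl, weight_of_mem_dilation h.pos hi]
    module
  · push Not at hex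
    rw [contControl_of_weight fun i => weight_of_notMem_dilation h.pos (hex i), control, dif_neg]
    rintro ⟨i, hi⟩
    exact hex i hi.1

lemma exists_lipschitzWith_contControl (h : Admissible U g xd ε) (k₁ κ : ℝ) :
    ∃ K : NNReal, LipschitzWith K (contControl U g xd k₁ κ ε) := by
  obtain ⟨K, hK⟩ := exists_lipschitzWith_sum Finset.univ
    (f := fun i y => (k₁ * (1 - weight ε (U i) y)) • ((xd : Amb n) + (1 / κ) • (g i : Amb n)))
    fun i => by
      refine ⟨‖k₁‖₊ * ‖ε⁻¹‖₊ * ‖(xd : Amb n) + (1 / κ) • (g i : Amb n)‖₊,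
        LipschitzWith.of_dist_le_mul fun y z => ?_⟩
      have h1 := (lipschitzWith_extDist (h.isClosed i) (h.nonempty i)).dist_le_mul y z
      rw [NNReal.coe_one, one_mul, Real.dist_eq] at h1
      have h2 : |weight ε (U i) y - weight ε (U i) z| ≤ |ε⁻¹| * dist y z := by
        refine (abs_min_sub_min_le_max _ _ _ _).trans ?_
        rw [sub_self, abs_zero, ← sub_div, abs_div, div_eq_inv_mul, ← abs_inv]
        exact max_le (by positivity) (mul_le_mul_of_nonneg_left h1 (abs_nonneg _))
      rw [dist_eq_norm, ← sub_smul, ← mul_sub, norm_smul, sub_sub_sub_cancel_left, norm_mul,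
        norm_sub_rev, Real.norm_eq_abs (_ - _)]
      push_cast
      rw [Real.norm_eq_abs ε⁻¹]
      calc ‖k₁‖ * |weight ε (U i) y - weight ε (U i) z| * ‖(xd : Amb n) + (1 / κ) • (g i : Amb n)‖
          ≤ ‖k₁‖ * (|ε⁻¹| * dist y z) * ‖(xd : Amb n) + (1 / κ) • (g i : Amb n)‖ := by gcongr
        _ = _ := by ring
  exact ⟨0 + K, (LipschitzWith.const _).sub hK⟩

end Admissible

/-! ### Forward invariance of the free space -/

/-- A path that ends in an open set and starts outside it has a last time outside it. -/
lemma exists_last_notMem {X : Type*} [TopologicalSpace X] {x : ℝ → X} {a b : ℝ} (hab : a ≤ b)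
    (hx : ContinuousOn x (Icc a b)) {O : Set X} (hO : IsOpen O) (ha : x a ∉ O) (hb : x b ∈ O) :
    ∃ t ∈ Ico a b, x t ∉ O ∧ ∀ s ∈ Ioc t b, x s ∈ O := by
  have hcl : IsClosed (Icc a b ∩ x ⁻¹' Oᶜ) :=
    hx.preimage_isClosed_of_isClosed isClosed_Icc hO.isClosed_compl
  have hbdd : BddAbove (Icc a b ∩ x ⁻¹' Oᶜ) := ⟨b, fun s hs => hs.1.2⟩
  have hmem := hcl.csSup_mem ⟨a, ⟨le_rfl, hab⟩, ha⟩ hbdd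
  set t := sSup (Icc a b ∩ x ⁻¹' Oᶜ)
  have htb : t ≠ b := fun h => hmem.2 (by rwa [h])
  refine ⟨t, ⟨hmem.1.1, lt_of_le_of_ne hmem.1.2 htb⟩, hmem.2, fun s hs => ?_⟩
  by_contra hsO
  exact absurd (le_csSup hbdd ⟨⟨hmem.1.1.trans hs.1.le, hs.2⟩, hsO⟩) (not_le.2 hs.1)

lemma IsSolutionOn.continuousOn {f : Sph n → Amb n} {I : Set ℝ} {x : ℝ → Sph n}
    (hx : IsSolutionOn f I x) : ContinuousOn x I := by
  rw [Topology.IsInducing.subtypeVal.continuousOn_iff]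
  exact fun t ht => (hx t ht).continuousWithinAt

lemma mem_of_forall_mem_Ioc {x : ℝ → Sph n} {t₀ t₁ : ℝ} (h : t₀ < t₁)
    (hx : ContinuousOn x (Icc t₀ t₁)) {C : Set (Sph n)} (hC : IsClosed C)
    (hmem : ∀ s ∈ Ioc t₀ t₁, x s ∈ C) : x t₀ ∈ C := by
  have h1 : Tendsto x (𝓝[>] t₀) (𝓝 (x t₀)) :=
    ((hx t₀ ⟨le_rfl, h.le⟩).mono_of_mem_nhdsWithin (Icc_mem_nhdsGT h)).tendsto
  refine hC.mem_of_tendsto h1 ?_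
  filter_upwards [Ioc_mem_nhdsGT h] with s hs using hmem s hs

namespace Admissible

variable {m : ℕ} {U : Fin m → Set (Sph n)} {g : Fin m → Sph n} {xd : Sph n} {k₁ κ ε : ℝ}

/-- The extended field pushes away from `g i` inside `U i`, and the interior of `U i` is closed
under motion towards `g i`; so no solution can enter it. -/
lemma notMem_interior_of_contControl (h : Admissible U g xd ε) (hk₁ : 0 < k₁) (hκ : 0 < κ)
    {x : ℝ → Sph n}
    (hx : IsSolutionOn (fun y => proj y (contControl U g xd k₁ κ ε y)) (Ici 0) x) {i : Fin m}
    (h0 : x 0 ∉ interior (U i)) {t : ℝ} (ht : 0 ≤ t) : x t ∉ interior (U i) := by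
  intro hmem
  have hc : ContinuousOn x (Icc 0 t) := hx.continuousOn.mono Icc_subset_Ici_self
  obtain ⟨t₀, ht₀, hout, hin⟩ := exists_last_notMem ht hc isOpen_interior h0 hmem
  have hc' : ContinuousOn x (Icc t₀ t) := hc.mono (Icc_subset_Icc_left ht₀.1)
  have hU : ∀ s ∈ Icc t₀ t, x s ∈ U i := fun s hs => by
    rcases hs.1.eq_or_lt with rfl | hlt
    · exact mem_of_forall_mem_Ioc ht₀.2 hc' (h.isClosed i) fun r hr => interior_subset (hin r hr)
    · exact interior_subset (hin s ⟨hlt, hs.2⟩)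
  obtain ⟨p, q, hp, hq0, hq, hlift⟩ := exists_lift_Icc ht₀.2.le hc' 0 (k₁ / κ) xd (g i)
    fun s hs => by
      have h1 := (hx s (ht₀.1.trans hs.1)).mono (Ici_subset_Ici.2 (ht₀.1.trans hs.1))
      have hmem' := subset_dilation h.pos.le (hU s ⟨hs.1, hs.2.le⟩)
      refine h1.congr_deriv ?_
      dsimp only
      rw [h.contControl_eq fun j hj => h.notMem_of_mem hmem' hj,
        weight_of_mem_dilation h.pos hmem', sdistSet_of_mem (hU s ⟨hs.1, hs.2.le⟩)]
      congr 1
      module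
  have hqmono : StrictMono q := strictMono_of_hasDerivAt_pos hq hp
  have hqt : 0 ≤ q t := hq0 ▸ hqmono.monotone ht₀.2.le
  have h1 := hlift t ⟨ht₀.2.le, le_rfl⟩
  refine hout (mem_interior_of_starCenter (h.starCenter i) hmem (hp t)
    (β := k₁ / κ * q t) (by positivity) ?_)
  rw [h1]
  module

/-- A solution of the discontinuous closed loop could enter the interior of `U i` only at a point
where the outer field `-(k₁ / κ) P(x) g` and the inner field `k₁ P(x) x_d` agree. From such a point
the inner flow moves along the great circle through `g i`, away from `g i`, so the point itself
would be interior. -/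
lemma notMem_interior_of_closedLoop (h : Admissible U g xd ε) (hk₁ : 0 < k₁) (hκ : 0 < κ)
    {x : ℝ → Sph n} {T : ℝ} (hx : IsSolutionOn (closedLoop U g xd k₁ κ ε) (Ico 0 T) x) {i : Fin m}
    (h0 : x 0 ∉ interior (U i)) {t : ℝ} (ht : t ∈ Ico 0 T) : x t ∉ interior (U i) := by
  intro hmem
  have hc : ContinuousOn x (Icc 0 t) := hx.continuousOn.mono (Icc_subset_Ico_right ht.2)
  obtain ⟨t₀, ht₀, hout, hin⟩ := exists_last_notMem ht.1 hc isOpen_interior h0 hmem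
  have hc' : ContinuousOn x (Icc t₀ t) := hc.mono (Icc_subset_Icc_left ht₀.1)
  have hU : x t₀ ∈ U i :=
    mem_of_forall_mem_Ioc ht₀.2 hc' (h.isClosed i) fun r hr => interior_subset (hin r hr)
  have hright : ∀ s ∈ Ico t₀ t, HasDerivWithinAt (fun r => (x r : Amb n))
      (closedLoop U g xd k₁ κ ε (x s)) (Ici s) s := fun s hs =>
    (hx s ⟨ht₀.1.trans hs.1, hs.2.trans ht.2⟩).mono_of_mem_nhdsWithin
      (mem_of_superset (Ico_mem_nhdsGE (hs.2.trans ht.2)) (Ico_subset_Ico_left (ht₀.1.trans hs.1)))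
  have hderiv : ∀ s ∈ Ioo t₀ t, HasDerivAt (fun r => (x r : Amb n))
      (proj (x s) (k₁ • (xd : Amb n))) s := fun s hs => by
    rw [← h.closedLoop_of_mem_interior (κ := κ) (hin s ⟨hs.1, hs.2.le⟩)]
    exact (hx s ⟨ht₀.1.trans hs.1.le, hs.2.trans ht.2⟩).hasDerivAt
      (Ico_mem_nhds (ht₀.1.trans_lt hs.1) (hs.2.trans ht.2))
  have hxc : Tendsto (fun s => (x s : Amb n)) (𝓝[>] t₀) (𝓝 (x t₀)) :=
    ((hright t₀ ⟨le_rfl, ht₀.2⟩).continuousWithinAt.mono Ioi_subset_Ici_self).tendsto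
  -- The right derivative at the last exit time is the limit of the inner field.
  have hlim : HasDerivWithinAt (fun r => (x r : Amb n)) (proj (x t₀) (k₁ • (xd : Amb n)))
      (Ici t₀) t₀ := by
    refine hasDerivWithinAt_Ici_of_tendsto_deriv
      (fun s hs => (hderiv s hs).differentiableAt.differentiableWithinAt)
      (hxc.mono_left (nhdsWithin_mono _ Ioo_subset_Ioi_self)) (Ioo_mem_nhdsGT ht₀.2) ?_
    have h1 : Tendsto (fun s => proj (x s) (k₁ • (xd : Amb n))) (𝓝[>] t₀)
        (𝓝 (proj (x t₀) (k₁ • (xd : Amb n)))) :=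
      tendsto_const_nhds.sub ((hxc.inner tendsto_const_nhds).smul hxc)
    refine h1.congr' ?_
    filter_upwards [Ioo_mem_nhdsGT ht₀.2] with s hs using (hderiv s hs).deriv.symm
  have heq : proj (x t₀) (k₁ • (xd : Amb n)) = proj (x t₀) (-(k₁ / κ) • (g i : Amb n)) := by
    rw [← h.closedLoop_of_mem_boundary hU hout]
    exact (uniqueDiffWithinAt_Ici t₀).eq_deriv _ hlim (hright t₀ ⟨le_rfl, ht₀.2⟩)
  obtain ⟨c, hc₀⟩ : ∃ c : ℝ, k₁ • (xd : Amb n) = c • (x t₀ : Amb n) - (k₁ / κ) • (g i : Amb n) := by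
    rw [proj, proj, sub_eq_iff_eq_add] at heq
    refine ⟨inner ℝ (x t₀ : Amb n) (k₁ • (xd : Amb n)) -
      inner ℝ (x t₀ : Amb n) (-(k₁ / κ) • (g i : Amb n)), heq.trans ?_⟩
    module
  obtain ⟨p, q, hp, hq0, hq, hlift⟩ := exists_lift_Icc ht₀.2.le hc' k₁ 0 xd 0
    fun s hs => by
      rw [zero_smul, sub_zero]
      rcases hs.1.eq_or_lt with rfl | hlt
      · exact hlim
      · exact (hderiv s ⟨hlt, hs.2⟩).hasDerivWithinAt
  have hqmono : StrictMono q := strictMono_of_hasDerivAt_pos hq hp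
  have hqc : Tendsto (fun s => 1 + q s * c) (𝓝[>] t₀) (𝓝 1) := by
    have h1 : ContinuousAt (fun s => 1 + q s * c) t₀ := by
      have := (hq t₀).continuousAt
      fun_prop
    have h2 := h1.tendsto.mono_left (nhdsWithin_le_nhds (s := Ioi t₀))
    rwa [hq0, zero_mul, add_zero] at h2
  obtain ⟨s, hs1, hs2⟩ := ((hqc.eventually (lt_mem_nhds one_pos)).and (Ioo_mem_nhdsGT ht₀.2)).exists
  have hqs : 0 ≤ q s := hq0 ▸ hqmono.monotone hs2.1.le
  have h1 := hlift s ⟨hs2.1.le, hs2.2.le⟩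
  refine hout (mem_interior_of_starCenter (h.starCenter i) (hin s ⟨hs2.1, hs2.2.le⟩)
    (α := (1 + q s * c)⁻¹ * p s) (β := (1 + q s * c)⁻¹ * (q s * (k₁ / κ)))
    (mul_pos (inv_pos.2 hs1) (hp s))
    (mul_nonneg (inv_nonneg.2 hs1.le) (by positivity)) ?_)
  rw [mul_smul, mul_smul, ← smul_add, eq_inv_smul_iff₀ hs1.ne', h1, mul_comm k₁, mul_smul, hc₀]
  module

lemma mem_freeSpace_of_closedLoop (h : Admissible U g xd ε) (hk₁ : 0 < k₁) (hκ : 0 < κ)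
    {x : ℝ → Sph n} {T : ℝ} (hx : IsSolutionOn (closedLoop U g xd k₁ κ ε) (Ico 0 T) x)
    (h0 : x 0 ∈ freeSpace 0 (⋃ i, U i)) {t : ℝ} (ht : t ∈ Ico 0 T) :
    x t ∈ freeSpace 0 (⋃ i, U i) := by
  rw [h.mem_freeSpace_iff] at h0 ⊢
  exact fun i => h.notMem_interior_of_closedLoop hk₁ hκ hx (h0 i) ht

theorem isForwardInvariant (h : Admissible U g xd ε) (hk₁ : 0 < k₁) (hκ : 0 < κ) :
    IsForwardInvariant (closedLoop U g xd k₁ κ ε) (freeSpace 0 (⋃ i, U i)) := by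
  refine ⟨fun x₀ hx₀ => ?_, fun T x hx h0 t ht => h.mem_freeSpace_of_closedLoop hk₁ hκ hx h0 ht⟩
  obtain ⟨K, hK⟩ := h.exists_lipschitzWith_contControl k₁ κ
  obtain ⟨x, hx0, hx⟩ := exists_solution_on_sphere hK.lipschitzOnWith x₀
  refine ⟨x, hx0, fun t ht => ?_⟩
  rw [h.mem_freeSpace_iff] at hx₀
  rw [h.closedLoop_eq (h.mem_freeSpace_iff.2 fun i =>
    h.notMem_interior_of_contControl hk₁ hκ hx (by rw [hx0]; exact hx₀ i) ht)]
  exact hx t ht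

end Admissible

/-! ### Trajectories in the free space and their order of visits -/

lemma exists_first_mem {X : Type*} [TopologicalSpace X] {x : ℝ → X} {a b : ℝ} (hab : a ≤ b)
    (hx : ContinuousOn x (Icc a b)) {C : Set X} (hC : IsClosed C) (ha : x a ∉ C) (hb : x b ∈ C) :
    ∃ t ∈ Ioc a b, x t ∈ C ∧ ∀ s ∈ Ico a t, x s ∉ C := by
  have hcl : IsClosed (Icc a b ∩ x ⁻¹' C) := hx.preimage_isClosed_of_isClosed isClosed_Icc hC
  have hbdd : BddBelow (Icc a b ∩ x ⁻¹' C) := ⟨a, fun s hs => hs.1.1⟩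
  have hmem := hcl.csInf_mem ⟨b, ⟨hab, le_rfl⟩, hb⟩ hbdd
  set t := sInf (Icc a b ∩ x ⁻¹' C)
  have hta : a ≠ t := fun h => ha (by rw [h]; exact hmem.2)
  refine ⟨t, ⟨lt_of_le_of_ne hmem.1.1 hta, hmem.1.2⟩, hmem.2, fun s hs hsC => ?_⟩
  exact absurd (csInf_le hbdd ⟨⟨hs.1, hs.2.le.trans hmem.1.2⟩, hsC⟩) (not_le.2 hs.2)

/-- A solution of the Lipschitz closed loop that stays in the free space for `t ≥ 0`; its values
at negative times only serve to make it continuous on the whole line. -/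
structure IsFreeTrajectory {m : ℕ} (U : Fin m → Set (Sph n)) (g : Fin m → Sph n) (xd : Sph n)
    (k₁ κ ε : ℝ) (x : ℝ → Sph n) : Prop where
  continuous : Continuous x
  deriv : ∀ s ≥ 0, HasDerivWithinAt (fun r => (x r : Amb n))
    (proj (x s) (contControl U g xd k₁ κ ε (x s))) (Ici s) s
  notMem : ∀ s ≥ 0, ∀ i, x s ∉ interior (U i)

open Classical in
/-- The rank of an unsafe region: the distance from the target to its dilation, or `⊤` if the
dilation contains the antipode of the target. Successive visits have decreasing rank. -/
def rank (ε : ℝ) (xd : Sph n) (A : Set (Sph n)) : WithTop ℝ :=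
  if -xd ∈ dilation ε A then ⊤ else (sdistSet xd (dilation ε A) : ℝ)

namespace Admissible

variable {m : ℕ} {U : Fin m → Set (Sph n)} {g : Fin m → Sph n} {xd : Sph n} {k₁ κ ε : ℝ}

lemma solution_contControl (h : Admissible U g xd ε) (hk₁ : 0 < k₁) (hκ : 0 < κ) {x : ℝ → Sph n}
    (hx : IsSolutionOn (closedLoop U g xd k₁ κ ε) (Ici 0) x)
    (h0 : x 0 ∈ freeSpace 0 (⋃ i, U i)) :
    (∀ t ≥ 0, x t ∈ freeSpace 0 (⋃ i, U i)) ∧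
      IsSolutionOn (fun y => proj y (contControl U g xd k₁ κ ε y)) (Ici 0) x := by
  have hfree : ∀ t ≥ 0, x t ∈ freeSpace 0 (⋃ i, U i) := fun t ht =>
    h.mem_freeSpace_of_closedLoop (T := t + 1) hk₁ hκ
      (fun s hs => (hx s hs.1).mono Ico_subset_Ici_self) h0 ⟨ht, lt_add_one t⟩
  refine ⟨hfree, fun t ht => ?_⟩
  dsimp only
  rw [← h.closedLoop_eq (hfree t ht)]
  exact hx t ht

lemma exists_isFreeTrajectory (h : Admissible U g xd ε) (hk₁ : 0 < k₁) (hκ : 0 < κ)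
    {x : ℝ → Sph n} (hx : IsSolutionOn (closedLoop U g xd k₁ κ ε) (Ici 0) x)
    (h0 : x 0 ∈ freeSpace 0 (⋃ i, U i)) :
    ∃ y : ℝ → Sph n, IsFreeTrajectory U g xd k₁ κ ε y ∧ ∀ t ≥ 0, y t = x t := by
  obtain ⟨hfree, hsol⟩ := h.solution_contControl hk₁ hκ hx h0
  have heq : ∀ t ≥ 0, x (max 0 t) = x t := fun t ht => by rw [max_eq_right ht]
  refine ⟨fun t => x (max 0 t), ⟨?_, fun s hs => ?_, fun s hs => ?_⟩, heq⟩
  · exact hx.continuousOn.comp_continuous (by fun_prop) fun t => le_max_left 0 t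
  · rw [heq s hs]
    refine ((hsol s hs).mono (Ici_subset_Ici.2 hs)).congr (fun r hr => ?_) (by rw [heq s hs])
    rw [heq r (le_trans hs hr)]
  · rw [heq s hs]
    exact h.mem_freeSpace_iff.1 (hfree s hs)

/-- Where at most one region is active, a trajectory moves in the cone of `x_d` and `-g i`. -/
lemma exists_lift_of_active (h : Admissible U g xd ε) {x : ℝ → Sph n}
    (hx : IsFreeTrajectory U g xd k₁ κ ε x) (i : Fin m) {t₀ : ℝ} (ht₀ : 0 ≤ t₀)
    (hact : ∀ s ≥ t₀, ∀ j, j ≠ i → x s ∉ dilation ε (U j)) :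
    ∃ p A B : ℝ → ℝ, (∀ t, 0 < p t) ∧ A t₀ = 0 ∧ B t₀ = 0 ∧
      (∀ t, HasDerivAt A (p t * (k₁ * weight ε (U i) (x t))) t) ∧
      (∀ t, HasDerivAt B (p t * (k₁ / κ * (1 - weight ε (U i) (x t)))) t) ∧
      ∀ t ≥ t₀, p t • (x t : Amb n) = x t₀ + A t • (xd : Amb n) - B t • (g i : Amb n) := by
  have hw : Continuous fun t => weight ε (U i) (x t) :=
    continuous_const.min (((continuous_sdistSet (h.isClosed i) (h.nonempty i)).comp
      hx.continuous).div_const ε)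
  obtain ⟨p, A, B, hp, hA0, hB0, hA, hB, hlift⟩ := exists_lift hx.continuous
    (α := fun t => k₁ * weight ε (U i) (x t)) (β := fun t => k₁ / κ * (1 - weight ε (U i) (x t)))
    (by fun_prop) (by fun_prop) (xd : Amb n) (g i : Amb n) t₀
  refine ⟨p, A, B, hp, hA0, hB0, hA, hB, fun t ht => hlift t ht fun s hs => ?_⟩
  rw [← h.contControl_eq (hact s hs.1)]
  exact hx.deriv s (ht₀.trans hs.1)

/-- Between visits to the dilations a trajectory moves along a geodesic towards the target. -/
lemma exists_lift_of_free (h : Admissible U g xd ε) (hk₁ : 0 < k₁) {x : ℝ → Sph n}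
    (hx : IsFreeTrajectory U g xd k₁ κ ε x) {t₀ t₁ : ℝ} (ht₀ : 0 ≤ t₀) (ht : t₀ < t₁)
    (hfree : ∀ s ∈ Ioo t₀ t₁, ∀ i, x s ∉ dilation ε (U i)) :
    ∃ p q : ℝ → ℝ, (∀ t, 0 < p t) ∧ q t₀ = 0 ∧ (∀ t, HasDerivAt q (k₁ * p t) t) ∧ Monotone q ∧
      ∀ t ∈ Icc t₀ t₁, p t • (x t : Amb n) = x t₀ + q t • (xd : Amb n) := by
  have hw : ∀ s ∈ Ico t₀ t₁, ∀ i, weight ε (U i) (x s) = 1 := by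
    intro s hs i
    rcases hs.1.eq_or_lt with rfl | hlt
    · obtain ⟨t, ht⟩ := exists_between hs.2
      refine weight_of_le h.pos (mem_of_forall_mem_Ioc ht.1 hx.continuous.continuousOn
        (C := {y | ε ≤ sdistSet y (U i)})
        (isClosed_le continuous_const (continuous_sdistSet (h.isClosed i) (h.nonempty i)))
        fun r hr => ?_)
      exact (not_le.1 (show ¬ sdistSet (x r) (U i) ≤ ε from
        hfree r ⟨hr.1, hr.2.trans_lt ht.2⟩ i)).le
    · exact weight_of_notMem_dilation h.pos (hfree s ⟨hlt, hs.2⟩ i)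
  obtain ⟨p, q, hp, hq0, hq, hlift⟩ := exists_lift_Icc ht.le hx.continuous.continuousOn k₁ 0
    (xd : Amb n) 0 fun s hs => by
      have h1 := hx.deriv s (ht₀.trans hs.1)
      rw [contControl_of_weight (hw s hs)] at h1
      simpa using h1
  have hq' : ∀ t, HasDerivAt (fun t => k₁ * q t) (k₁ * p t) t := fun t => (hq t).const_mul k₁
  refine ⟨p, fun t => k₁ * q t, hp, by simp [hq0], hq',
    (strictMono_of_hasDerivAt_pos hq' fun t => mul_pos hk₁ (hp t)).monotone, fun t ht => ?_⟩
  rw [hlift t ht]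
  module

lemma mem_region_of_mem_dilation (h : Admissible U g xd ε) {i : Fin m} {x : Sph n}
    (hx : x ∈ dilation ε (U i)) (hx' : x ∉ interior (U i)) : x ∈ region ε xd (U i) := by
  rw [region]
  by_cases hd : -xd ∈ dilation ε (U i)
  · rw [if_neg (not_not.2 hd)]
    refine ⟨mem_iUnion₂.2 ⟨x, hx, mem_geodesic_of_nonneg (fun he => h.target_notMem i ?_)
      zero_le_one le_rfl (by module)⟩, hx'⟩
    rw [neg_neg] at he
    rwa [← he]
  · rw [if_pos hd]
    refine ⟨⟨mem_iUnion₂.2 ⟨x, hx, mem_geodesic_of_nonneg (fun he => hd ?_) zero_le_one le_rfl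
      (by module)⟩, hx'⟩, ?_⟩
    · rwa [← he]
    · rw [sdist_comm]
      exact sdistSet_le hx xd

/-- On the way from the `i`-th dilation to the next one, the trajectory stays on a geodesic through
the target. If the rank did not drop, the regions attached to the two would intersect. -/
lemma rank_lt_of_consecutive (h : Admissible U g xd ε) (hk₁ : 0 < k₁) {x : ℝ → Sph n}
    (hx : IsFreeTrajectory U g xd k₁ κ ε x) {t₀ t₁ : ℝ} (ht₀ : 0 ≤ t₀) (ht : t₀ < t₁)
    (hfree : ∀ s ∈ Ioo t₀ t₁, ∀ i, x s ∉ dilation ε (U i)) {i j : Fin m} (hij : i ≠ j)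
    (hi : x t₀ ∈ dilation ε (U i)) (hj : x t₁ ∈ dilation ε (U j)) :
    rank ε xd (U j) < rank ε xd (U i) := by
  obtain ⟨p, q, hp, hq0, -, hq, hlift⟩ := h.exists_lift_of_free hk₁ hx ht₀ ht hfree
  have hqt : 0 ≤ q t₁ := hq0 ▸ hq ht.le
  have hpt := hp t₁
  have hl := hlift t₁ ⟨ht.le, le_rfl⟩
  have hdisj := Set.disjoint_left.1 (h.region_disjoint i j hij)
  have hout₀ := hx.notMem t₀ ht₀
  have hout₁ := hx.notMem t₁ (ht₀.trans ht.le)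
  rw [rank, rank]
  by_cases hdj : -xd ∈ dilation ε (U j)
  · refine absurd ?_ (hdisj (h.mem_region_of_mem_dilation hi (hout₀ i)))
    rw [region, if_neg (not_not.2 hdj)]
    refine ⟨mem_iUnion₂.2 ⟨x t₁, hj, mem_geodesic_of_nonneg (fun he => h.target_notMem j ?_)
      hpt.le hqt ?_⟩, hout₀ j⟩
    · rw [neg_neg] at he
      rwa [← he]
    · rw [hl, show ((-xd : Sph n) : Amb n) = -(xd : Amb n) from rfl]
      module
  rw [if_neg hdj]
  by_cases hdi : -xd ∈ dilation ε (U i)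
  · rw [if_pos hdi]
    exact WithTop.coe_lt_top _
  rw [if_neg hdi, WithTop.coe_lt_coe]
  by_contra! hle
  refine hdisj ?_ (h.mem_region_of_mem_dilation hj (hout₁ j))
  rw [region, if_pos hdi]
  refine ⟨⟨mem_iUnion₂.2 ⟨x t₀, hi, mem_geodesic_of_nonneg (α := (p t₁)⁻¹) (β := (p t₁)⁻¹ * q t₁)
    (fun he => hdi ?_) (by positivity) (by positivity) ?_⟩, hout₁ i⟩, ?_⟩
  · rwa [← he]
  · rw [mul_smul, ← smul_add, eq_inv_smul_iff₀ hpt.ne', hl]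
  · rw [sdist_comm]
    exact hle.trans (sdistSet_le hj xd)

lemma eq_or_rank_lt (h : Admissible U g xd ε) (hk₁ : 0 < k₁) {x : ℝ → Sph n}
    (hx : IsFreeTrajectory U g xd k₁ κ ε x) {s t : ℝ} (hs : 0 ≤ s) (hst : s ≤ t) {i j : Fin m}
    (hi : x s ∈ dilation ε (U i)) (hj : x t ∈ dilation ε (U j)) :
    j = i ∨ rank ε xd (U j) < rank ε xd (U i) := by
  by_contra hcon
  -- Split the regions into those allowed after `i` and the others, and look at the first visit to
  -- the second kind and the last visit to the first kind before it.
  set I : Set (Fin m) := {k | k = i ∨ rank ε xd (U k) < rank ε xd (U i)} with hI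
  have hcl : ∀ J : Set (Fin m), IsClosed (⋃ k ∈ J, dilation ε (U k)) := fun J =>
    (Set.toFinite J).isClosed_biUnion fun k _ => h.isClosed_dilation k
  have hsep : ∀ {y : Sph n} {k l : Fin m}, y ∈ dilation ε (U k) → y ∈ dilation ε (U l) → k = l :=
    fun {y k l} hk hl => by
      by_contra hkl
      exact h.notMem_of_mem hl hkl hk
  have hc := fun a b => hx.continuous.continuousOn (s := Icc a b)
  obtain ⟨b, hb, hbI, hbfirst⟩ := exists_first_mem hst (hc s t) (hcl Iᶜ)
    (fun hmem => by
      obtain ⟨k, hk, hxk⟩ := mem_iUnion₂.1 hmem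
      exact hk (Or.inl (hsep hxk hi)))
    (mem_iUnion₂.2 ⟨j, hcon, hj⟩)
  obtain ⟨l, hl, hxl⟩ := mem_iUnion₂.1 hbI
  obtain ⟨a, ha, haI, halast⟩ := exists_last_notMem hb.1.le (hc s b) (hcl I).isOpen_compl
    (fun hmem => hmem (mem_iUnion₂.2 ⟨i, Or.inl rfl, hi⟩))
    (fun hmem => by
      obtain ⟨k, hk, hxk⟩ := mem_iUnion₂.1 hmem
      rw [hsep hxl hxk] at hl
      exact hl hk)
  rw [mem_compl_iff, not_not] at haI
  obtain ⟨k, hk, hxk⟩ := mem_iUnion₂.1 haI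
  have hkl : k ≠ l := fun hkl => hl (hkl ▸ hk)
  have hlt := h.rank_lt_of_consecutive hk₁ hx (hs.trans ha.1) ha.2 (fun r hr q hq => by
    by_cases hqI : q ∈ I
    · exact halast r ⟨hr.1, hr.2.le⟩ (mem_iUnion₂.2 ⟨q, hqI, hq⟩)
    · exact hbfirst r ⟨ha.1.trans hr.1.le, hr.2⟩ (mem_iUnion₂.2 ⟨q, hqI, hq⟩)) hkl hxk hxl
  refine hl (Or.inr ?_)
  rcases hk with rfl | hk
  · exact hlt
  · exact hlt.trans hk

/-- From some time on a trajectory visits at most one dilation. -/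
lemma exists_last_active (h : Admissible U g xd ε) (hm : 1 ≤ m) (hk₁ : 0 < k₁) {x : ℝ → Sph n}
    (hx : IsFreeTrajectory U g xd k₁ κ ε x) :
    ∃ i, ∃ s ≥ 0, ∀ t ≥ s, ∀ j, j ≠ i → x t ∉ dilation ε (U j) := by
  by_cases hvis : {i | ∃ t ≥ 0, x t ∈ dilation ε (U i)}.Nonempty
  · obtain ⟨i, ⟨s, hs, hi⟩, hmin⟩ := Set.exists_min_image _ (fun i => rank ε xd (U i))
      (Set.toFinite {i | ∃ t ≥ 0, x t ∈ dilation ε (U i)}) hvis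
    refine ⟨i, s, hs, fun t ht j hji hj => ?_⟩
    rcases h.eq_or_rank_lt hk₁ hx hs ht hi hj with h1 | h1
    · exact hji h1
    · exact absurd (hmin j ⟨t, hs.trans ht, hj⟩) (not_le.2 h1)
  · refine ⟨⟨0, hm⟩, 0, le_rfl, fun t ht j _ hj => hvis ⟨j, t, ht, hj⟩⟩

end Admissible

/-! ### Convergence near the target -/

lemma sdist_le_of_lift {x y a : Sph n} {p K : ℝ} (hp : 0 < p) (hK : 0 ≤ K)
    (hc : sdist y a ≤ 1) (h : p • (x : Amb n) = y + K • (a : Amb n)) :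
    sdist x a ≤ sdist y a ∧ K * sdist x a ≤ 1 ∧ 1 ≤ p := by
  have hn : ‖(y : Amb n) + K • (a : Amb n)‖ = p := by
    rw [← h, norm_smul, norm_coe, mul_one, Real.norm_of_nonneg hp.le]
  have hsq : p ^ 2 = 1 + 2 * (K * inner ℝ (y : Amb n) (a : Amb n)) + K ^ 2 := by
    rw [← hn, norm_add_sq_real, norm_smul, norm_coe, norm_coe, real_inner_smul_right,
      Real.norm_of_nonneg hK]
    ring
  have hin : p * inner ℝ (x : Amb n) (a : Amb n) = inner ℝ (y : Amb n) (a : Amb n) + K := by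
    rw [← real_inner_smul_left, h, inner_add_left, real_inner_smul_left, inner_coe_self, mul_one]
  have hpK : p ≤ 1 + K := by
    have h1 := norm_add_le (y : Amb n) (K • (a : Amb n))
    rwa [hn, norm_smul, norm_coe, norm_coe, mul_one, Real.norm_of_nonneg hK] at h1
  have h1 := inner_coe_le_one y a
  rw [sdist] at hc
  rw [sdist, sdist]
  set c := inner ℝ (y : Amb n) (a : Amb n)
  have hc0 : 0 ≤ c := by linarith
  have hp1 : 1 ≤ p := by nlinarith [mul_nonneg hK hc0]
  have hKp : K ≤ p := by nlinarith [mul_nonneg hK hc0]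
  refine ⟨?_, ?_, hp1⟩
  · have h2 : p * c ≤ p * inner ℝ (x : Amb n) (a : Amb n) := by rw [hin]; nlinarith
    linarith [le_of_mul_le_mul_left h2 hp]
  · have h2 : 0 ≤ 1 - inner ℝ (x : Amb n) (a : Amb n) := by linarith [inner_coe_le_one x a]
    nlinarith

namespace Admissible

variable {m : ℕ} {U : Fin m → Set (Sph n)} {g : Fin m → Sph n} {xd : Sph n} {k₁ κ ε : ℝ}

lemma exists_radius (h : Admissible U g xd ε) :
    ∃ r > 0, r ≤ 1 ∧ ∀ x : Sph n, sdist x xd < r → ∀ i, x ∉ dilation ε (U i) := by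
  have h1 : IsClosed (⋃ i, dilation ε (U i)) := isClosed_iUnion_of_finite h.isClosed_dilation
  have h2 : xd ∈ (⋃ i, dilation ε (U i))ᶜ := by simpa using h.target_notMem
  obtain ⟨ρ, hρ, hball⟩ := Metric.isOpen_iff.1 h1.isOpen_compl xd h2
  refine ⟨min 1 (ρ ^ 2 / 2), by positivity, min_le_left _ _, fun x hx i hi => ?_⟩
  refine hball (?_ : dist x xd < ρ) (mem_iUnion.2 ⟨i, hi⟩)
  have h3 := norm_sub_sq_eq_sdist x xd
  rw [Subtype.dist_eq, dist_eq_norm]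
  refine lt_of_pow_lt_pow_left₀ 2 hρ.le ?_
  linarith [hx.trans_le (min_le_right 1 (ρ ^ 2 / 2))]

lemma sdist_lt_of_near (h : Admissible U g xd ε) (hk₁ : 0 < k₁) {x : ℝ → Sph n}
    (hx : IsFreeTrajectory U g xd k₁ κ ε x) {r : ℝ} (hr1 : r ≤ 1)
    (hr : ∀ x : Sph n, sdist x xd < r → ∀ i, x ∉ dilation ε (U i)) {t₀ t : ℝ} (ht₀ : 0 ≤ t₀)
    (h0 : sdist (x t₀) xd < r) (ht : t₀ ≤ t) : sdist (x t) xd < r := by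
  by_contra! hcon
  have hC : IsClosed {y : Sph n | r ≤ sdist y xd} :=
    isClosed_le continuous_const (by unfold sdist; fun_prop)
  obtain ⟨b, hb, hbC, hfirst⟩ := exists_first_mem ht hx.continuous.continuousOn hC
    (not_le.2 h0) hcon
  obtain ⟨p, q, hp, hq0, -, hq, hlift⟩ := h.exists_lift_of_free hk₁ hx ht₀ hb.1
    fun s hs => hr _ (not_le.1 (hfirst s ⟨hs.1.le, hs.2⟩))
  have h1 := (sdist_le_of_lift (hp b) (hq0 ▸ hq hb.1.le) (h0.le.trans hr1)
    (hlift b ⟨hb.1.le, le_rfl⟩)).1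
  have h2 : r ≤ sdist (x b) xd := hbC
  linarith

lemma tendsto_of_near (h : Admissible U g xd ε) (hk₁ : 0 < k₁) {x : ℝ → Sph n}
    (hx : IsFreeTrajectory U g xd k₁ κ ε x) {r : ℝ} (hr1 : r ≤ 1)
    (hr : ∀ x : Sph n, sdist x xd < r → ∀ i, x ∉ dilation ε (U i)) {t₀ : ℝ} (ht₀ : 0 ≤ t₀)
    (h0 : sdist (x t₀) xd < r) : Tendsto (fun t => sdist (x t) xd) atTop (𝓝 0) := by
  have hbound : ∀ t > t₀, sdist (x t) xd ≤ (k₁ * (t - t₀))⁻¹ := by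
    intro t ht
    obtain ⟨p, q, hp, hq0, hq, hqm, hlift⟩ := h.exists_lift_of_free hk₁ hx ht₀ ht
      fun s hs => hr _ (h.sdist_lt_of_near hk₁ hx hr1 hr ht₀ h0 hs.1.le)
    have hkey := fun s (hs : s ∈ Icc t₀ t) => sdist_le_of_lift (hp s) (hq0 ▸ hqm hs.1)
      (h0.le.trans hr1) (hlift s hs)
    have hgrow := (convex_Icc t₀ t).mul_sub_le_image_sub_of_le_deriv
      (continuous_iff_continuousAt.2 fun s => (hq s).continuousAt).continuousOn
      (fun s _ => (hq s).differentiableAt.differentiableWithinAt) (C := k₁)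
      (fun s hs => by
        rw [(hq s).deriv]
        exact le_mul_of_one_le_right hk₁.le (hkey s (interior_subset hs)).2.2)
      t₀ ⟨le_rfl, ht.le⟩ t ⟨ht.le, le_rfl⟩ ht.le
    rw [hq0, sub_zero] at hgrow
    have hpos : 0 < k₁ * (t - t₀) := mul_pos hk₁ (sub_pos.2 ht)
    rw [← one_div, le_div_iff₀ hpos, mul_comm]
    exact (mul_le_mul_of_nonneg_right hgrow (sdist_nonneg _ _)).trans
      (hkey t ⟨ht.le, le_rfl⟩).2.1
  have hlim : Tendsto (fun t => (k₁ * (t - t₀))⁻¹) atTop (𝓝 0) :=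
    ((tendsto_atTop_add_const_right atTop (-t₀) tendsto_id).const_mul_atTop hk₁).inv_tendsto_atTop
  refine tendsto_of_tendsto_of_tendsto_of_le_of_le' tendsto_const_nhds hlim
    (Eventually.of_forall fun t => sdist_nonneg _ _) ?_
  filter_upwards [eventually_gt_atTop t₀] with t ht using hbound t ht

/-! ### Escape from an active region -/

/-- The arc from the target to `-g i` avoids `U i`: otherwise the geodesic from `g i` to a point
of `U i` on that arc would pass through the target. By compactness the arc keeps a positive distance
from `U i`, expressed here homogeneously. -/
lemma exists_gap (h : Admissible U g xd ε) (i : Fin m) :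
    ∃ d > 0, ∀ a b : ℝ, 0 ≤ a → 0 ≤ b → ∀ y ∈ U i,
      inner ℝ (a • (xd : Amb n) - b • (g i : Amb n)) (y : Amb n) ≤
        ‖a • (xd : Amb n) - b • (g i : Amb n)‖ - d * (a + b) := by
  set z : ℝ → Amb n := fun l => (1 - l) • (xd : Amb n) - l • (g i : Amb n) with hz
  have hcont : Continuous fun l => ‖z l‖ - 1 + extDist (U i) (z l) := by
    have h1 := (lipschitzWith_extDist (h.isClosed i) (h.nonempty i)).continuous
    have h2 : Continuous z := by fun_prop
    fun_prop
  have hxd : xd ∉ U i := fun hmem => h.target_notMem i (subset_dilation h.pos.le hmem)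
  have hpos : ∀ l ∈ Icc (0 : ℝ) 1, 0 < ‖z l‖ - 1 + extDist (U i) (z l) := by
    intro l hl
    obtain ⟨y, hy, hye⟩ := exists_extDist_eq (h.isClosed i) (h.nonempty i) (z l)
    rw [hye]
    have h1 := inner_le_norm_coe (z l) y
    by_contra! hcon
    -- Equality in Cauchy-Schwarz puts `z l` on the ray through `y ∈ U i`.
    have h2 : z l = ‖z l‖ • (y : Amb n) := by
      have h3 : inner ℝ (z l) (y : Amb n) = ‖z l‖ * ‖(y : Amb n)‖ := by
        rw [norm_coe]
        linarith
      rw [inner_eq_norm_mul_iff_real, norm_coe, one_smul] at h3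
      exact h3
    rcases hl.2.eq_or_lt with rfl | hlt
    · have h4 : z 1 = -(g i : Amb n) := by simp [hz]
      rw [h4, norm_neg, norm_coe, one_smul] at h2
      refine (h.starCenter i).2.1 ?_
      rwa [show -g i = y from Subtype.ext h2]
    · have h4 : 0 < 1 - l := sub_pos.2 hlt
      refine hxd (mem_of_starCenter (h.starCenter i) hy (α := (1 - l)⁻¹ * ‖z l‖)
        (β := (1 - l)⁻¹ * l) (by positivity) (mul_nonneg (inv_nonneg.2 h4.le) hl.1) ?_)
      rw [mul_smul, mul_smul, ← smul_add, eq_inv_smul_iff₀ h4.ne', ← h2, hz]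
      module
  obtain ⟨l₀, hl₀, hmin⟩ := isCompact_Icc.exists_isMinOn (nonempty_Icc.2 zero_le_one)
    hcont.continuousOn
  refine ⟨_, hpos l₀ hl₀, fun a b ha hb y hy => ?_⟩
  rcases (add_nonneg ha hb).eq_or_lt with hab | hab
  · have ha0 : a = 0 := by linarith
    have hb0 : b = 0 := by linarith
    simp [ha0, hb0]
  have hl : b / (a + b) ∈ Icc (0 : ℝ) 1 := ⟨by positivity, (div_le_one hab).2 (by linarith)⟩
  have hzab : a • (xd : Amb n) - b • (g i : Amb n) = (a + b) • z (b / (a + b)) := by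
    have h1 : (a + b) * (1 - b / (a + b)) = a := by field_simp; ring
    have h2 : (a + b) * (b / (a + b)) = b := by field_simp
    rw [hz]
    dsimp only
    rw [smul_sub, smul_smul, smul_smul, h1, h2]
  have h1 := isMinOn_iff.1 hmin _ hl
  have h2 := extDist_le hy (z (b / (a + b)))
  rw [hzab, real_inner_smul_left, norm_smul, Real.norm_of_nonneg hab.le]
  nlinarith

/-- If only the `i`-th region is active and the trajectory is off the plane of `x_d` and `g i`, it
reaches a given neighbourhood of the target. Writing `p x = x(s) + A x_d - B g`, the coefficients
cannot stay bounded because `p` is at least the distance of `x(s)` to the plane; so `x` approaches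
the arc from `x_d` to `-g`, hence stays away from `U i`, and there the attractive coefficient `A`
outgrows `B` by the factor `κ`. -/
lemma exists_sdist_lt (h : Admissible U g xd ε) (hk₁ : 0 < k₁) (hκ : 0 < κ) {x : ℝ → Sph n}
    (hx : IsFreeTrajectory U g xd k₁ κ ε x) {i : Fin m} {d : ℝ} (hd : 0 < d)
    (hgap : ∀ a b : ℝ, 0 ≤ a → 0 ≤ b → ∀ y ∈ U i,
      inner ℝ (a • (xd : Amb n) - b • (g i : Amb n)) (y : Amb n) ≤
        ‖a • (xd : Amb n) - b • (g i : Amb n)‖ - d * (a + b))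
    {r : ℝ} (hr : 0 < r) (hr1 : r ≤ 1) (hκr : 4 < κ * min 1 (d / 2 / ε) * r) {s : ℝ} (hs : 0 ≤ s)
    (hact : ∀ t ≥ s, ∀ j, j ≠ i → x t ∉ dilation ε (U j))
    (hplane : (x s : Amb n) ∉ Submodule.span ℝ {(xd : Amb n), (g i : Amb n)}) :
    ∃ t ≥ s, sdist (x t) xd < r := by
  obtain ⟨p, A, B, hp, hA0, hB0, hA, hB, hlift⟩ := h.exists_lift_of_active hx i hs hact
  have hε := h.pos
  set W : Submodule ℝ (Amb n) := Submodule.span ℝ {(xd : Amb n), (g i : Amb n)} with hW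
  have hxdW : (xd : Amb n) ∈ W := Submodule.subset_span (by simp)
  have hgW : (g i : Amb n) ∈ W := Submodule.subset_span (by simp)
  set w : ℝ → ℝ := fun t => weight ε (U i) (x t) with hw
  have hw0 : ∀ t, 0 ≤ w t := fun t => weight_nonneg hε (U i) (x t)
  have hw1 : ∀ t, w t ≤ 1 := fun t => weight_le_one ε (U i) (x t)
  have hAm : Monotone A := monotone_of_hasDerivAt_nonneg hA fun t =>
    mul_nonneg (hp t).le (mul_nonneg hk₁.le (hw0 t))
  have hBm : Monotone B := monotone_of_hasDerivAt_nonneg hB fun t =>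
    mul_nonneg (hp t).le (mul_nonneg (by positivity) (sub_nonneg.2 (hw1 t)))
  have hAs : ∀ t ≥ s, 0 ≤ A t := fun t ht => hA0 ▸ hAm ht
  have hBs : ∀ t ≥ s, 0 ≤ B t := fun t ht => hB0 ▸ hBm ht
  have hnorm : ∀ t ≥ s, p t = ‖(x s : Amb n) + A t • (xd : Amb n) - B t • (g i : Amb n)‖ := by
    intro t ht
    rw [← hlift t ht, norm_smul, norm_coe, mul_one, Real.norm_of_nonneg (hp t).le]
  set c := Metric.infDist (x s : Amb n) W with hc
  have hc0 : 0 < c :=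
    (W.closed_of_finiteDimensional.notMem_iff_infDist_pos ⟨0, W.zero_mem⟩).1 hplane
  have hpc : ∀ t ≥ s, c ≤ p t := by
    intro t ht
    rw [hnorm t ht]
    have hmem : B t • (g i : Amb n) - A t • (xd : Amb n) ∈ W :=
      W.sub_mem (W.smul_mem _ hgW) (W.smul_mem _ hxdW)
    refine (Metric.infDist_le_dist_of_mem hmem).trans_eq ?_
    rw [dist_eq_norm]
    congr 1
    module
  have hp1 : ∀ t ≥ s, p t ≤ 1 + A t + B t := by
    intro t ht
    rw [hnorm t ht]
    refine (norm_sub_le _ _).trans ?_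
    have h1 := norm_add_le (x s : Amb n) (A t • (xd : Amb n))
    rw [norm_smul, norm_coe, norm_coe, Real.norm_of_nonneg (hAs t ht), mul_one] at h1
    rw [norm_smul, norm_coe, Real.norm_of_nonneg (hBs t ht), mul_one]
    linarith
  -- `A + κ B` grows at least linearly.
  have hgrow : ∀ t ≥ s, c * k₁ * (t - s) ≤ A t + κ * B t := by
    intro t ht
    have hd' : ∀ r, HasDerivAt (fun r => A r + κ * B r) (p r * k₁) r := fun r =>
      ((hA r).add ((hB r).const_mul κ)).congr_deriv (by field_simp; ring)
    have h1 := (convex_Icc s t).mul_sub_le_image_sub_of_le_deriv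
      (continuous_iff_continuousAt.2 fun r => (hd' r).continuousAt).continuousOn
      (fun r _ => (hd' r).differentiableAt.differentiableWithinAt) (C := c * k₁)
      (fun r hr => by
        rw [(hd' r).deriv]
        exact mul_le_mul_of_nonneg_right (hpc r (interior_subset hr).1) hk₁.le)
      s ⟨le_rfl, ht⟩ t ⟨ht, le_rfl⟩ ht
    simpa [hA0, hB0] using h1
  obtain ⟨t₁, ht₁s, ht₁⟩ : ∃ t₁ ≥ s, ∀ t ≥ t₁, 4 + d ≤ d * (A t + B t) := by
    set S := (1 + κ) * ((4 + d) / d) with hS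
    refine ⟨s + S / (c * k₁), by simp only [ge_iff_le, le_add_iff_nonneg_right]; positivity,
      fun t ht => ?_⟩
    have hst : s ≤ t := le_trans (by simp only [le_add_iff_nonneg_right]; positivity) ht
    have h1 : S ≤ c * k₁ * (t - s) := by
      rw [← div_le_iff₀' (by positivity)]
      linarith
    have h2 : S ≤ (1 + κ) * (A t + B t) := by
      nlinarith [hgrow t hst, hAs t hst, hBs t hst]
    have h3 := le_of_mul_le_mul_left h2 (by positivity)
    rw [div_le_iff₀' hd] at h3
    exact h3
  set w₀ := min 1 (d / 2 / ε) with hw₀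
  have hw₀pos : 0 < w₀ := by positivity
  have hfar : ∀ t ≥ t₁, w₀ ≤ w t := by
    intro t ht
    have hst := ht₁s.le.trans ht
    obtain ⟨y, hy, hye⟩ := exists_extDist_eq (h.isClosed i) (h.nonempty i) (x t : Amb n)
    have h1 := hgap (A t) (B t) (hAs t hst) (hBs t hst) y hy
    have h2 : p t * inner ℝ (x t : Amb n) (y : Amb n) = inner ℝ (x s : Amb n) (y : Amb n) +
        inner ℝ (A t • (xd : Amb n) - B t • (g i : Amb n)) (y : Amb n) := by
      rw [← real_inner_smul_left, hlift t hst, ← inner_add_left]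
      congr 1
      module
    have h3 : ‖A t • (xd : Amb n) - B t • (g i : Amb n)‖ ≤ p t + 1 := by
      have e : A t • (xd : Amb n) - B t • (g i : Amb n) = p t • (x t : Amb n) - x s := by
        rw [hlift t hst]
        module
      rw [e]
      refine (norm_sub_le _ _).trans ?_
      rw [norm_smul, norm_coe, norm_coe, mul_one, Real.norm_of_nonneg (hp t).le]
    have h4 : p t * (d / 2) ≤ p t * extDist (U i) (x t) := by
      rw [hye]
      nlinarith [inner_coe_le_one (x s) y, hp1 t hst, ht₁ t ht]
    have h5 := le_of_mul_le_mul_left h4 (hp t)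
    exact min_le_min_left 1 (div_le_div_of_nonneg_right h5 hε.le)
  set η := (κ * w₀)⁻¹ with hη
  have hη0 : 0 < η := by positivity
  have hηr : 4 * η < r := by
    rw [hη, ← div_eq_mul_inv, div_lt_iff₀ (by positivity)]
    linarith
  -- Far from `U i` the repulsive coefficient grows at most `η` times as fast as the attractive one.
  have hBA : ∀ t ≥ t₁, B t ≤ B t₁ + η * A t := by
    intro t ht
    have hd' : ∀ r, HasDerivAt (fun r => η * A r - B r)
        (η * (p r * (k₁ * w r)) - p r * (k₁ / κ * (1 - w r))) r := fun r =>
      ((hA r).const_mul η).sub (hB r)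
    have h1 := (convex_Icc t₁ t).mul_sub_le_image_sub_of_le_deriv
      (continuous_iff_continuousAt.2 fun r => (hd' r).continuousAt).continuousOn
      (fun r _ => (hd' r).differentiableAt.differentiableWithinAt) (C := 0)
      (fun r hr => by
        rw [(hd' r).deriv]
        have h2 := hfar r (interior_subset hr).1
        have h3 : 1 / κ ≤ η * w r := by
          rw [hη, mul_inv, mul_assoc, one_div]
          refine le_mul_of_one_le_right (by positivity) ?_
          rwa [inv_mul_eq_div, one_le_div hw₀pos]
        have h4 : 1 / κ * (1 - w r) ≤ 1 / κ := mul_le_of_le_one_right (by positivity)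
          (by linarith [hw0 r])
        have h5 := mul_nonneg (mul_nonneg (hp r).le hk₁.le) (sub_nonneg.2 (h4.trans h3))
        refine h5.trans_eq ?_
        ring)
      t₁ ⟨le_rfl, ht⟩ t ⟨ht, le_rfl⟩ ht
    have h2 := mul_nonneg hη0.le (hAs t₁ ht₁s)
    linarith
  have hAlim : ∀ M : ℝ, ∃ t ≥ t₁, M ≤ A t := by
    intro M
    refine ⟨max t₁ (s + (max 0 (κ * B t₁ + (1 + κ * η) * M)) / (c * k₁)), le_max_left _ _, ?_⟩
    set t := max t₁ (s + (max 0 (κ * B t₁ + (1 + κ * η) * M)) / (c * k₁)) with ht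
    have ht1 : t₁ ≤ t := le_max_left _ _
    have h1 : max 0 (κ * B t₁ + (1 + κ * η) * M) ≤ c * k₁ * (t - s) := by
      rw [← div_le_iff₀' (by positivity)]
      linarith [le_max_right t₁ (s + (max 0 (κ * B t₁ + (1 + κ * η) * M)) / (c * k₁))]
    have h2 := hgrow t (ht₁s.le.trans ht1)
    have h3 := mul_le_mul_of_nonneg_left (hBA t ht1) hκ.le
    have h4 : (1 + κ * η) * M ≤ (1 + κ * η) * A t := by
      linarith [le_max_right 0 (κ * B t₁ + (1 + κ * η) * M)]
    exact le_of_mul_le_mul_left h4 (by positivity)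
  obtain ⟨t, ht, hAt⟩ := hAlim (4 / r * (2 + 3 * B t₁ + 1) + 1)
  have hst := ht₁s.le.trans ht
  refine ⟨t, hst, ?_⟩
  have hin : p t * inner ℝ (x t : Amb n) (xd : Amb n) ≥ A t - B t - 1 := by
    rw [← real_inner_smul_left, hlift t hst, inner_sub_left, inner_add_left,
      real_inner_smul_left, real_inner_smul_left, inner_coe_self]
    have h1 : -1 ≤ inner ℝ (x s : Amb n) (xd : Amb n) := by
      have := neg_le_of_abs_le (abs_real_inner_le_norm (x s : Amb n) (xd : Amb n))
      rwa [norm_coe, norm_coe, one_mul] at this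
    have h2 := mul_le_mul_of_nonneg_left (inner_coe_le_one (g i) xd) (hBs t hst)
    linarith
  have hBt := hBA t ht
  have h1 := hBs t₁ ht₁s
  have h2 : 4 * (2 + 3 * B t₁ + 1) < r * A t := by
    have h3 : r * (4 / r * (2 + 3 * B t₁ + 1) + 1) = 4 * (2 + 3 * B t₁ + 1) + r := by field_simp
    nlinarith
  have h3 : p t * sdist (x t) xd ≤ 2 + 2 * B t := by
    rw [sdist]
    linarith [hp1 t hst]
  have hA' := hAs t hst
  have h4 : p t ≥ A t - B t - 1 := by
    have h5 := mul_le_mul_of_nonneg_left (inner_coe_le_one (x t) xd) (hp t).le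
    linarith
  have h5 : 2 + 2 * B t < p t * r := by
    nlinarith
  exact lt_of_mul_lt_mul_left (h3.trans_lt h5) (hp t).le

end Admissible

/-! ### Almost global convergence -/

/-- The exceptional initial conditions: those of solutions that lie in the plane of `x_d` and some
`g i` at some rational time. Rational times suffice because a trajectory that enters such a plane
while no other region is active remains in it. -/
def exceptionalSet {m : ℕ} (U : Fin m → Set (Sph n)) (g : Fin m → Sph n) (xd : Sph n)
    (k₁ κ ε : ℝ) : Set (Sph n) :=
  ⋃ (q : ℚ) (i : Fin m), {x₀ | x₀ ∈ freeSpace 0 (⋃ i, U i) ∧ 0 ≤ q ∧ ∃ x : ℝ → Sph n,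
    IsSolutionOn (closedLoop U g xd k₁ κ ε) (Ici 0) x ∧ x 0 = x₀ ∧
      (x q : Amb n) ∈ Submodule.span ℝ {(xd : Amb n), (g i : Amb n)}}

namespace Admissible

variable {m : ℕ} {U : Fin m → Set (Sph n)} {g : Fin m → Sph n} {xd : Sph n} {k₁ κ ε : ℝ}

lemma toSphere_exceptionalSet (h : Admissible U g xd ε) (hn : 2 ≤ n) (hk₁ : 0 < k₁) (hκ : 0 < κ) :
    (volume : Measure (Amb n)).toSphere (exceptionalSet U g xd k₁ κ ε) = 0 := by
  obtain ⟨K, hK⟩ := h.exists_lipschitzWith_contControl k₁ κ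
  refine measure_iUnion_null fun q => measure_iUnion_null fun i => ?_
  by_cases hq : 0 ≤ q
  swap
  · simp [hq]
  have hq' : (0 : ℝ) ≤ q := by exact_mod_cast hq
  obtain ⟨L, hL⟩ := dist_zero_le_of_solutions
    (hK.lipschitzOnWith (s := Metric.closedBall 0 1)) hq'
  have hsol : ∀ z : Sph n, ∃ x : ℝ → Sph n,
      z ∈ {x₀ | x₀ ∈ freeSpace 0 (⋃ i, U i) ∧ 0 ≤ q ∧ ∃ x : ℝ → Sph n,
        IsSolutionOn (closedLoop U g xd k₁ κ ε) (Ici 0) x ∧ x 0 = x₀ ∧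
          (x q : Amb n) ∈ Submodule.span ℝ {(xd : Amb n), (g i : Amb n)}} →
      IsSolutionOn (fun y => proj y (contControl U g xd k₁ κ ε y)) (Ici 0) x ∧ x 0 = z ∧
        (x q : Amb n) ∈ Submodule.span ℝ {(xd : Amb n), (g i : Amb n)} := by
    intro z
    by_cases hz : z ∈ {x₀ | x₀ ∈ freeSpace 0 (⋃ i, U i) ∧ 0 ≤ q ∧ ∃ x : ℝ → Sph n,
        IsSolutionOn (closedLoop U g xd k₁ κ ε) (Ici 0) x ∧ x 0 = x₀ ∧
          (x q : Amb n) ∈ Submodule.span ℝ {(xd : Amb n), (g i : Amb n)}}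
    · obtain ⟨hz0, -, x, hx, rfl, hxq⟩ := hz
      exact ⟨x, fun _ => ⟨(h.solution_contControl hk₁ hκ hx hz0).2, rfl, hxq⟩⟩
    · exact ⟨fun _ => z, fun hz' => absurd hz' hz⟩
  choose φ hφ using hsol
  refine toSphere_eq_zero_of_mem_plane hn (φ := fun z => φ z q) (L := L)
    (fun z hz => (hφ z hz).2.2) fun z hz w hw => ?_
  have h1 := hL (φ z) (φ w) (hφ z hz).1 (hφ w hw).1
  rwa [(hφ z hz).2.1, (hφ w hw).2.1] at h1

lemma tendsto_of_notMem_exceptionalSet (h : Admissible U g xd ε) (hm : 1 ≤ m) (hk₁ : 0 < k₁)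
    (hκ : 0 < κ) {r : ℝ} (hr0 : 0 < r) (hr1 : r ≤ 1)
    (hr : ∀ x : Sph n, sdist x xd < r → ∀ i, x ∉ dilation ε (U i)) {d : Fin m → ℝ}
    (hd : ∀ i, 0 < d i)
    (hgap : ∀ i, ∀ a b : ℝ, 0 ≤ a → 0 ≤ b → ∀ y ∈ U i,
      inner ℝ (a • (xd : Amb n) - b • (g i : Amb n)) (y : Amb n) ≤
        ‖a • (xd : Amb n) - b • (g i : Amb n)‖ - d i * (a + b))
    (hκr : ∀ i, 4 < κ * min 1 (d i / 2 / ε) * r) {x : ℝ → Sph n}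
    (hx : IsSolutionOn (closedLoop U g xd k₁ κ ε) (Ici 0) x)
    (h0 : x 0 ∈ freeSpace 0 (⋃ i, U i)) (hZ : x 0 ∉ exceptionalSet U g xd k₁ κ ε) :
    Tendsto (fun t => sdist (x t) xd) atTop (𝓝 0) := by
  obtain ⟨y, hy, hyx⟩ := h.exists_isFreeTrajectory hk₁ hκ hx h0
  obtain ⟨i, s, hs, hact⟩ := h.exists_last_active hm hk₁ hy
  have hplane : (y s : Amb n) ∉ Submodule.span ℝ {(xd : Amb n), (g i : Amb n)} := by
    intro hmem
    obtain ⟨p, A, B, hp, -, -, -, -, hlift⟩ := h.exists_lift_of_active hy i hs hact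
    obtain ⟨q, hq, -⟩ := exists_rat_btwn (lt_add_one s)
    have hq0 : (0 : ℝ) ≤ q := hs.trans hq.le
    refine hZ (mem_iUnion₂.2 ⟨q, i, h0, by exact_mod_cast hq0, x, hx, rfl, ?_⟩)
    rw [← hyx q hq0]
    rw [← Submodule.smul_mem_iff _ (hp q).ne', hlift q hq.le]
    exact Submodule.sub_mem _ (Submodule.add_mem _ hmem
      (Submodule.smul_mem _ _ (Submodule.subset_span (by simp))))
      (Submodule.smul_mem _ _ (Submodule.subset_span (by simp)))
  obtain ⟨t, ht, hlt⟩ := h.exists_sdist_lt hk₁ hκ hy (hd i) (hgap i) hr0 hr1 (hκr i) hs hact hplane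
  refine (h.tendsto_of_near hk₁ hy hr1 hr (hs.trans ht) hlt).congr' ?_
  filter_upwards [eventually_ge_atTop 0] with t ht using by rw [hyx t ht]

lemma closedLoop_target (h : Admissible U g xd ε) : closedLoop U g xd k₁ κ ε xd = 0 := by
  rw [closedLoop, control, dif_neg]
  · rw [proj, real_inner_smul_right, inner_coe_self, mul_one, sub_self]
  · rintro ⟨i, hi⟩
    exact h.target_notMem i hi.1

theorem exists_isAGAS (h : Admissible U g xd ε) (hn : 2 ≤ n) (hm : 1 ≤ m) (hk₁ : 0 < k₁) :
    ∃ κbar : ℝ, 0 < κbar ∧ ∀ κ : ℝ, κbar < κ →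
      IsAGAS (closedLoop U g xd k₁ κ ε) (freeSpace 0 (⋃ i, U i)) xd := by
  obtain ⟨r, hr0, hr1, hr⟩ := h.exists_radius
  choose d hd hgap using h.exists_gap
  obtain ⟨C, hC⟩ := (Set.finite_range fun i => 4 / (min 1 (d i / 2 / ε) * r)).bddAbove
  refine ⟨max 1 C, by positivity, fun κ hκ => ?_⟩
  have hκ0 : 0 < κ := one_pos.trans_le ((le_max_left 1 C).trans hκ.le)
  have hκr : ∀ i, 4 < κ * min 1 (d i / 2 / ε) * r := fun i => by
    have h1 : 0 < d i / 2 / ε := div_pos (half_pos (hd i)) h.pos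
    have h2 := (hC (mem_range_self i)).trans_lt ((le_max_right 1 C).trans_lt hκ)
    rw [div_lt_iff₀ (by positivity)] at h2
    rwa [mul_assoc]
  refine ⟨h.closedLoop_target, fun ρ hρ => ?_, ⟨r, hr0, fun x hx h0 hlt => ?_⟩,
    ⟨exceptionalSet U g xd k₁ κ ε, ?_, h.toSphere_exceptionalSet hn hk₁ hκ0, fun x hx h0 =>
      h.tendsto_of_notMem_exceptionalSet hm hk₁ hκ0 hr0 hr1 hr hd hgap hκr hx h0.1 h0.2⟩⟩
  · refine ⟨min r ρ, lt_min hr0 hρ, fun x hx h0 hlt t ht => ?_⟩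
    obtain ⟨y, hy, hyx⟩ := h.exists_isFreeTrajectory hk₁ hκ0 hx h0
    rw [← hyx t ht]
    refine (h.sdist_lt_of_near hk₁ hy ((min_le_left r ρ).trans hr1)
      (fun z hz => hr z (hz.trans_le (min_le_left r ρ))) le_rfl ?_ ht).trans_le (min_le_right r ρ)
    rwa [hyx 0 le_rfl]
  · obtain ⟨y, hy, hyx⟩ := h.exists_isFreeTrajectory hk₁ hκ0 hx h0
    refine (h.tendsto_of_near hk₁ hy hr1 hr le_rfl (by rwa [hyx 0 le_rfl])).congr' ?_
    filter_upwards [eventually_ge_atTop 0] with t ht using by rw [hyx t ht]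
  · exact iUnion₂_subset fun q i x hx => hx.1

end Admissible

lemma admissible_of_separated {m : ℕ} {U : Fin m → Set (Sph n)} (hclosed : ∀ i, IsClosed (U i))
    {g : Fin m → Sph n} (hg : ∀ i, g i ∈ starCenters (U i) ∩ interior (U i)) {xd : Sph n}
    (hxd : xd ∉ interior (⋃ i, U i)) {δ : ℝ} (hδ : δ ≤ 2)
    (hsep : ∀ i j, i ≠ j → ∀ a ∈ U i, ∀ b ∈ U j, δ ≤ sdist a b) {εbar : ℝ}
    (hxdε : xd ∉ nbhd εbar (⋃ i, U i)) {ε : ℝ} (hε : ε ∈ Ioo 0 (min εbar (Phi δ)))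
    (hregion : ∀ i j, i ≠ j → region ε xd (U i) ∩ region ε xd (U j) = ∅) :
    Admissible U g xd ε := by
  have hne : ∀ i, (U i).Nonempty := fun i => ⟨g i, (hg i).1.1⟩
  refine ⟨hclosed, fun i => (hg i).1, hε.1, fun i j hij =>
    disjoint_dilation (hclosed i) (hne i) (hclosed j) (hne j) hδ
      (hε.2.trans_le (min_le_right _ _)) (hsep i j hij), fun i hi => hxdε ⟨?_, hxd⟩,
    fun i j hij => Set.disjoint_iff_inter_eq_empty.2 (hregion i j hij)⟩
  exact (sdistSet_anti (subset_iUnion U i) (hne i) xd).trans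
    (le_trans hi (hε.2.le.trans (min_le_left _ _)))

end SphereNav

end

theorem theorem2 (n : ℕ) (hn : 2 ≤ n) (m : ℕ) (hm : 1 ≤ m)
    (U : Fin m → Set (SphereNav.Sph n)) (hclosed : ∀ i, IsClosed (U i))
    (hstar : ∀ i, SphereNav.IsStarShaped (U i))
    (g : Fin m → SphereNav.Sph n)
    (hg : ∀ i, g i ∈ SphereNav.starCenters (U i) ∩ interior (U i))
    (xd : SphereNav.Sph n)
    (hxd : xd ∈ interior (SphereNav.freeSpace 0 (⋃ i, U i)))
    (hgxd : ∀ i, g i ≠ -xd)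
    (δ : ℝ) (hδ : δ ∈ Set.Icc (0 : ℝ) 2)
    (hsep : ∀ i j, i ≠ j → ∀ a ∈ U i, ∀ b ∈ U j, δ ≤ SphereNav.sdist a b)
    (εbar : ℝ) (hεbar : 0 < εbar) (hxdε : xd ∉ SphereNav.nbhd εbar (⋃ i, U i))
    (ε : ℝ) (hε : ε ∈ Set.Ioo 0 (min εbar (SphereNav.Phi δ)))
    (hregion : ∀ i j, i ≠ j →
      SphereNav.region ε xd (U i) ∩ SphereNav.region ε xd (U j) = ∅)
    (k₁ : ℝ) (hk₁ : 0 < k₁) :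
    (∀ κ : ℝ, 0 < κ →
      SphereNav.IsForwardInvariant (SphereNav.closedLoop U g xd k₁ κ ε)
        (SphereNav.freeSpace 0 (⋃ i, U i))) ∧
    ∃ κbar : ℝ, 0 < κbar ∧ ∀ κ : ℝ, κbar < κ →
      SphereNav.IsAGAS (SphereNav.closedLoop U g xd k₁ κ ε)
        (SphereNav.freeSpace 0 (⋃ i, U i)) xd := by
  have h := SphereNav.admissible_of_separated hclosed hg (interior_subset hxd).1 hδ.2 hsep
    hxdε hε hregion
  exact ⟨fun κ hκ => h.isForwardInvariant hk₁ hκ, h.exists_isAGAS hn hm hk₁⟩
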